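/- Let $L>0$, let $\mathbb T=\mathbb T_L^d$ be the $d$-dimensional torus of side length $L$, let $\mu\in\mathbb R$, $h>0$, and let $W:\mathbb T\to\mathbb R$ be a continuous interaction kernel which is $H$-stable: $\iint_{\mathbb T\times\mathbb T} W(x-y)m(x)m(y)\,dx\,dy\ge 0$ for every integrable $m\ge 0$. Let $N_0\in\mathcal B$, i.e. $N_0\in L^2(\mathbb T)$ and $N_0\ge c$ a.e. for some constant $c>0$. Put $w_{N_0}(x)=\int_{\mathbb T}W(x-y)N_0(y)\,dy$ and $$\Omega_{N_0}=\frac{N_0e^{-\frac12(\mu-w_{N_0})}-e^{\frac12(\mu-w_{N_0})}}{\log N_0-\mu+w_{N_0}},$$ with the limiting value $\sqrt{N_0}$ where the denominator vanishes. Let $\mathcal H_{N_0}$ be the space of weakly differentiable $\phi:\mathbb T\to\mathbb R$ with $\int_{\mathbb T}N_0|\nabla\phi|^2+\Omega_{N_0}\phi^2\,dx<\infty$, with the inner product $\langle\!\langle\nabla\phi,\nabla\psi\rangle\!\rangle_{N_0}=\int_{\mathbb T}N_0\nabla\phi\cdot\nabla\psi+\Omega_{N_0}\phi\psi\,dx$,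 and let $\mathcal H_{N_0}^{-1}$ be its dual. A functional $N\in\mathcal H_{N_0}^{-1}$ is said to be an $L^1$ function if there is $n\in L^1(\mathbb T)$ with $N[\psi]=\int_{\mathbb T} n\psi\,dx$ for all bounded $\psi\in\mathcal H_{N_0}$. For $N\in\mathcal H_{N_0}^{-1}$ let $$\mathbb D_A^2(N_0,N)=\inf_\phi\; h\int_0^h\langle\!\langle\nabla\phi_t,\nabla\phi_t\rangle\!\rangle_{N_0}\,dt,$$ the infimum over all fields $\phi\in L^2((0,h);\mathcal H_{N_0})$ for which the weak solution of $\partial_tN_t=\nabla\cdot(N_0\nabla\phi_t)-\Omega_{N_0}\phi_t$ with initial value $N_{t=0}=N_0$, that is, $N_t[\psi]=\int_{\mathbb T}N_0\psi\,dx-\int_0^t\langle\!\langle\nabla\phi_s,\nabla\psi\rangle\!\rangle_{N_0}ds$ for all $\psi\in\mathcal H_{N_0}$, satisfies $N_{t=h}=N$. Let $$\mathscr G_\mu(N)=\int_{\mathbb T}\big(N\log N-[N+\mu N]\big)dx+\frac12\iint_{\mathbb T\times\mathbb T}W(x-y)N(x)N(y)\,dx\,dy\in(-\infty,+\infty]$$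 if $N$ is a nonnegative $L^1$ function, and $\mathscr G_\mu(N)=+\infty$ for all other $N\in\mathcal H_{N_0}^{-1}$. Then the functional $\mathbb J_A(N_0,\cdot)=\frac12\mathbb D_A^2(N_0,\cdot)+h\,\mathscr G_\mu(\cdot)$ has a minimizer in $\mathcal H_{N_0}^{-1}$. Moreover the minimum is finite, and every minimizer is a (nonnegative) $L^1$ function. -/

import Mathlib

open MeasureTheory Set
open scoped ENNReal ContDiff

namespace GrandCanonical

noncomputable section

/-- The `d`-dimensional torus of side length `L`; its `volume` is Lebesgue measure, of total
mass `L ^ d`. -/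
abbrev Torus (d : ℕ) (L : ℝ) : Type := Fin d → AddCircle L

/-- The vector space `ℝ^d` with its Euclidean norm. -/
abbrev Vec (d : ℕ) : Type := EuclideanSpace ℝ (Fin d)

/-- The class of densities on the torus which are in `L²` and uniformly bounded below by a
positive constant. -/
structure Density (d : ℕ) (L : ℝ) [Fact (0 < L)] where
  toFun : Torus d L → ℝ
  memLp : MemLp toFun 2 (volume : Measure (Torus d L))
  bounded_below : ∃ c : ℝ, 0 < c ∧ ∀ᵐ x, c ≤ toFun x

/-- H-stability: `∫∫ W (x - y) m x m y ≥ 0` for all (integrable) `m ≥ 0`. -/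
def HStable {d : ℕ} {L : ℝ} [Fact (0 < L)] (W : C(Torus d L, ℝ)) : Prop :=
  ∀ m : Torus d L → ℝ, Integrable m → (∀ x, 0 ≤ m x) →
    0 ≤ ∫ x, ∫ y, W (x - y) * m x * m y

/-- The potential `w_N (x) = ∫ W (x - y) N y dy`. -/
def convPot {d : ℕ} {L : ℝ} [Fact (0 < L)] (W : C(Torus d L, ℝ)) (N : Torus d L → ℝ)
    (x : Torus d L) : ℝ :=
  ∫ y, W (x - y) * N y

/-- `(n e^{-(μ - w)/2} - e^{(μ - w)/2}) / (log n - μ + w)`, with its limiting value `√n` where the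
denominator (hence also the numerator) vanishes. -/
def omegaVal (μ n w : ℝ) : ℝ :=
  if Real.log n - μ + w = 0 then √n
  else (n * Real.exp (-(1 / 2) * (μ - w)) - Real.exp (1 / 2 * (μ - w))) / (Real.log n - μ + w)

/-- The coefficient `Ω_N`. -/
def omega {d : ℕ} {L : ℝ} [Fact (0 < L)] (W : C(Torus d L, ℝ)) (μ : ℝ) (N : Density d L)
    (x : Torus d L) : ℝ :=
  omegaVal μ (N.toFun x) (convPot W N.toFun x)

/-- The measure `Ω_N dx`. -/
def omegaMeasure {d : ℕ} {L : ℝ} [Fact (0 < L)] (W : C(Torus d L, ℝ)) (μ : ℝ)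
    (N : Density d L) : Measure (Torus d L) :=
  volume.withDensity fun x => ENNReal.ofReal (omega W μ N x)

/-- The measure `N dx`. -/
def densityMeasure {d : ℕ} {L : ℝ} [Fact (0 < L)] (N : Density d L) : Measure (Torus d L) :=
  volume.withDensity fun x => ENNReal.ofReal (N.toFun x)

theorem omegaVal_pos {μ n w : ℝ} (hn : 0 < n) : 0 < omegaVal μ n w := by
  unfold omegaVal
  split_ifs with h
  · exact Real.sqrt_pos.2 hn
  · have e : n * Real.exp (-(1 / 2) * (μ - w)) - Real.exp (1 / 2 * (μ - w))
        = Real.exp (Real.log n - 1 / 2 * (μ - w)) - Real.exp (1 / 2 * (μ - w)) := by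
      rw [sub_eq_add_neg (Real.log n), Real.exp_add, Real.exp_log hn, neg_mul]
    rw [e]
    rcases lt_or_gt_of_ne h with h' | h'
    · refine div_pos_of_neg_of_neg (sub_neg.2 (Real.exp_lt_exp.2 ?_)) h'
      linarith
    · refine div_pos (sub_pos.2 (Real.exp_lt_exp.2 ?_)) h'
      linarith

theorem measurable_omegaVal (μ : ℝ) :
    Measurable fun p : ℝ × ℝ => omegaVal μ p.1 p.2 := by
  unfold omegaVal
  refine Measurable.ite ?_ (by fun_prop) (by fun_prop)
  exact measurableSet_eq_fun (by fun_prop) (by fun_prop)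

theorem aemeasurable_omega {d : ℕ} {L : ℝ} [Fact (0 < L)] (W : C(Torus d L, ℝ)) (μ : ℝ)
    (N : Density d L) : AEMeasurable (omega W μ N) volume := by
  have hw : AEMeasurable (convPot W N.toFun) (volume : Measure (Torus d L)) := by
    refine AEStronglyMeasurable.aemeasurable ?_
    refine AEStronglyMeasurable.integral_prod_right'
      (f := fun p : Torus d L × Torus d L => W (p.1 - p.2) * N.toFun p.2) ?_
    refine AEStronglyMeasurable.mul ?_ N.memLp.1.comp_snd
    exact (by fun_prop : Continuous fun p : Torus d L × Torus d L =>
      W (p.1 - p.2)).aestronglyMeasurable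
  exact (measurable_omegaVal μ).comp_aemeasurable (N.memLp.1.aemeasurable.prodMk hw)

theorem volume_ac_omegaMeasure {d : ℕ} {L : ℝ} [Fact (0 < L)] (W : C(Torus d L, ℝ)) (μ : ℝ)
    (N : Density d L) : (volume : Measure (Torus d L)) ≪ omegaMeasure W μ N := by
  obtain ⟨c, hc, h⟩ := N.bounded_below
  refine withDensity_absolutelyContinuous' (aemeasurable_omega W μ N).ennreal_ofReal ?_
  filter_upwards [h] with x hx
  exact (ENNReal.ofReal_pos.2 (omegaVal_pos (hc.trans_le hx))).ne'

theorem volume_ac_densityMeasure {d : ℕ} {L : ℝ} [Fact (0 < L)] (N : Density d L) :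
    (volume : Measure (Torus d L)) ≪ densityMeasure N := by
  obtain ⟨c, hc, h⟩ := N.bounded_below
  refine withDensity_absolutelyContinuous' N.memLp.1.aemeasurable.ennreal_ofReal ?_
  filter_upwards [h] with x hx
  exact (ENNReal.ofReal_pos.2 (hc.trans_le hx)).ne'

/-- Smooth functions on the torus: the periodic lift to `ℝ^d` is smooth. -/
def IsSmooth {d : ℕ} {L : ℝ} (η : Torus d L → ℝ) : Prop :=
  ContDiff ℝ ∞ fun x : Fin d → ℝ => η fun i => (x i : AddCircle L)

/-- The `i`-th partial derivative on the torus. -/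
def partialDeriv {d : ℕ} {L : ℝ} (i : Fin d) (η : Torus d L → ℝ) (x : Torus d L) : ℝ :=
  deriv (fun t : ℝ => η (x + Pi.single i (t : AddCircle L))) 0

/-- The vector field `g` is the weak gradient of `φ` on the torus. -/
structure HasWeakGradient {d : ℕ} {L : ℝ} [Fact (0 < L)] (φ : Torus d L → ℝ)
    (g : Torus d L → Vec d) : Prop where
  integrable : Integrable φ
  integrable_grad : Integrable g
  parts : ∀ η : Torus d L → ℝ, IsSmooth η → ∀ i : Fin d,
    ∫ x, φ x * partialDeriv i η x = -∫ x, g x i * η x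

theorem IsSmooth.continuous {d : ℕ} {L : ℝ} {η : Torus d L → ℝ} (h : IsSmooth η) :
    Continuous η := by
  have hq : IsOpenQuotientMap fun (x : Fin d → ℝ) (i : Fin d) => (x i : AddCircle L) :=
    IsOpenQuotientMap.piMap fun _ => QuotientAddGroup.isOpenQuotientMap_mk
  exact hq.isQuotientMap.continuous_iff.2 (ContDiff.continuous h)

theorem IsSmooth.continuous_partialDeriv {d : ℕ} {L : ℝ} {η : Torus d L → ℝ} (h : IsSmooth η)
    (i : Fin d) : Continuous (partialDeriv i η) := by
  have hq : IsOpenQuotientMap fun (x : Fin d → ℝ) (i : Fin d) => (x i : AddCircle L) :=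
    IsOpenQuotientMap.piMap fun _ => QuotientAddGroup.isOpenQuotientMap_mk
  refine hq.isQuotientMap.continuous_iff.2 ?_
  have h1 : Differentiable ℝ fun x : Fin d → ℝ => η fun i => (x i : AddCircle L) :=
    ContDiff.differentiable h (by simp)
  have key : ∀ x : Fin d → ℝ, partialDeriv i η (fun j => (x j : AddCircle L))
      = fderiv ℝ (fun x : Fin d → ℝ => η fun i => (x i : AddCircle L)) x (Pi.single i 1) := by
    intro x
    have hl : HasDerivAt (fun t : ℝ => x + t • (Pi.single i 1 : Fin d → ℝ))
        (Pi.single i 1) 0 := by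
      simpa using ((hasDerivAt_id (0 : ℝ)).smul_const (Pi.single i 1 : Fin d → ℝ)).const_add x
    have h2 := (h1 (x + (0 : ℝ) • (Pi.single i 1 : Fin d → ℝ))).hasFDerivAt.comp_hasDerivAt
      (0 : ℝ) hl
    rw [zero_smul, add_zero] at h2
    rw [← h2.deriv]
    unfold partialDeriv
    congr 1
    funext t
    simp only [Function.comp]
    congr 1
    funext j
    by_cases hj : j = i
    · subst hj; simp
    · simp [hj]
  have h3 : Continuous fun x : Fin d → ℝ =>
      fderiv ℝ (fun x : Fin d → ℝ => η fun i => (x i : AddCircle L)) x (Pi.single i 1) :=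
    (ContDiff.continuous_fderiv h (by simp)).clm_apply continuous_const
  exact h3.congr fun x => (key x).symm

theorem integrable_mul_of_continuous {d : ℕ} {L : ℝ} [Fact (0 < L)] {f b : Torus d L → ℝ}
    (hf : Integrable f) (hb : Continuous b) : Integrable fun x => f x * b x := by
  obtain ⟨C, hC⟩ := (isCompact_range hb).isBounded.exists_norm_le
  exact hf.mul_bdd hb.aestronglyMeasurable (c := C)
    (Filter.Eventually.of_forall fun x => hC _ ⟨x, rfl⟩)

theorem integrable_coord {d : ℕ} {L : ℝ} [Fact (0 < L)] {g : Torus d L → Vec d}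
    (hg : Integrable g) (i : Fin d) : Integrable fun x => g x i :=
  (EuclideanSpace.proj (𝕜 := ℝ) i).integrable_comp hg

theorem HasWeakGradient.congr {d : ℕ} {L : ℝ} [Fact (0 < L)] {φ φ' : Torus d L → ℝ}
    {g g' : Torus d L → Vec d} (h : HasWeakGradient φ g)
    (hφ : φ' =ᵐ[volume] φ) (hg : g' =ᵐ[volume] g) : HasWeakGradient φ' g' where
  integrable := h.integrable.congr hφ.symm
  integrable_grad := h.integrable_grad.congr hg.symm
  parts η hη i := by
    have e1 : ∫ x, φ' x * partialDeriv i η x = ∫ x, φ x * partialDeriv i η x :=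
      integral_congr_ae (by filter_upwards [hφ] with x hx; rw [hx])
    have e2 : ∫ x, g' x i * η x = ∫ x, g x i * η x :=
      integral_congr_ae (by filter_upwards [hg] with x hx; rw [hx])
    rw [e1, e2, h.parts η hη i]

theorem HasWeakGradient.add {d : ℕ} {L : ℝ} [Fact (0 < L)] {φ φ' : Torus d L → ℝ}
    {g g' : Torus d L → Vec d} (h : HasWeakGradient φ g) (h' : HasWeakGradient φ' g') :
    HasWeakGradient (φ + φ') (g + g') where
  integrable := h.integrable.add h'.integrable
  integrable_grad := h.integrable_grad.add h'.integrable_grad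
  parts η hη i := by
    have a1 := integrable_mul_of_continuous h.integrable (hη.continuous_partialDeriv i)
    have a2 := integrable_mul_of_continuous h'.integrable (hη.continuous_partialDeriv i)
    have b1 := integrable_mul_of_continuous (integrable_coord h.integrable_grad i) hη.continuous
    have b2 := integrable_mul_of_continuous (integrable_coord h'.integrable_grad i) hη.continuous
    simp only [Pi.add_apply, PiLp.add_apply, add_mul]
    rw [integral_add a1 a2, integral_add b1 b2, h.parts η hη i, h'.parts η hη i]
    ring

theorem HasWeakGradient.smul {d : ℕ} {L : ℝ} [Fact (0 < L)] {φ : Torus d L → ℝ}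
    {g : Torus d L → Vec d} (c : ℝ) (h : HasWeakGradient φ g) :
    HasWeakGradient (c • φ) (c • g) where
  integrable := h.integrable.smul c
  integrable_grad := h.integrable_grad.smul c
  parts η hη i := by
    simp only [Pi.smul_apply, PiLp.smul_apply, smul_eq_mul, mul_assoc]
    rw [integral_const_mul, integral_const_mul, h.parts η hη i]
    ring

theorem HasWeakGradient.zero {d : ℕ} {L : ℝ} [Fact (0 < L)] :
    HasWeakGradient (0 : Torus d L → ℝ) 0 where
  integrable := integrable_zero _ _ _
  integrable_grad := integrable_zero _ _ _
  parts η _ i := by simp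

/-- The space `ℋ_N` of driving fields: the potentials `φ` on the torus with a weak gradient `∇φ`
such that `∫ N |∇φ|² + Ω_N φ² dx < ∞`, realized as the pairs `(φ, ∇φ)` inside
`L²(Ω_N dx) × L²(N dx; ℝ^d)`.  The inner product which it inherits is
`⟪φ, ψ⟫ = ∫ N ∇φ · ∇ψ + Ω_N φ ψ dx` (see `inner_eq` below). -/
def PotentialSpace {d : ℕ} {L : ℝ} [Fact (0 < L)] (W : C(Torus d L, ℝ)) (μ : ℝ)
    (N : Density d L) :
    Submodule ℝ (WithLp 2 (Lp ℝ 2 (omegaMeasure W μ N) × Lp (Vec d) 2 (densityMeasure N))) where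
  carrier := {p | HasWeakGradient (p.fst : Torus d L → ℝ) (p.snd : Torus d L → Vec d)}
  add_mem' {p q} hp hq := HasWeakGradient.congr (HasWeakGradient.add hp hq)
    ((volume_ac_omegaMeasure W μ N).ae_eq (Lp.coeFn_add p.fst q.fst))
    ((volume_ac_densityMeasure N).ae_eq (Lp.coeFn_add p.snd q.snd))
  zero_mem' := HasWeakGradient.congr HasWeakGradient.zero
    ((volume_ac_omegaMeasure W μ N).ae_eq (Lp.coeFn_zero _ _ _))
    ((volume_ac_densityMeasure N).ae_eq (Lp.coeFn_zero _ _ _))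
  smul_mem' c p hp := HasWeakGradient.congr (HasWeakGradient.smul c hp)
    ((volume_ac_omegaMeasure W μ N).ae_eq (Lp.coeFn_smul c p.fst))
    ((volume_ac_densityMeasure N).ae_eq (Lp.coeFn_smul c p.snd))

/-- The potential `φ` as a function. -/
def potential {d : ℕ} {L : ℝ} [Fact (0 < L)] {W : C(Torus d L, ℝ)} {μ : ℝ} {N : Density d L}
    (φ : PotentialSpace W μ N) : Torus d L → ℝ :=
  (φ : WithLp 2 (Lp ℝ 2 (omegaMeasure W μ N) × Lp (Vec d) 2 (densityMeasure N))).fst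

/-- Its weak gradient `∇φ` as a vector field. -/
def gradient {d : ℕ} {L : ℝ} [Fact (0 < L)] {W : C(Torus d L, ℝ)} {μ : ℝ} {N : Density d L}
    (φ : PotentialSpace W μ N) : Torus d L → Vec d :=
  (φ : WithLp 2 (Lp ℝ 2 (omegaMeasure W μ N) × Lp (Vec d) 2 (densityMeasure N))).snd

theorem inner_eq {d : ℕ} {L : ℝ} [Fact (0 < L)] {W : C(Torus d L, ℝ)} {μ : ℝ}
    {N : Density d L} (φ ψ : PotentialSpace W μ N) :
    inner ℝ φ ψ = (∫ x, N.toFun x * inner ℝ (gradient φ x) (gradient ψ x))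
      + ∫ x, omega W μ N x * (potential φ x * potential ψ x) := by
  obtain ⟨c, hc, h⟩ := N.bounded_below
  rw [Submodule.coe_inner, WithLp.prod_inner_apply, L2.inner_def, L2.inner_def, add_comm]
  congr 1
  · unfold densityMeasure
    rw [integral_withDensity_eq_integral_toReal_smul₀ N.memLp.1.aemeasurable.ennreal_ofReal
      (by simp)]
    refine integral_congr_ae ?_
    filter_upwards [h] with x hx
    rw [ENNReal.toReal_ofReal (hc.le.trans hx), smul_eq_mul]
    rfl
  · unfold omegaMeasure
    rw [integral_withDensity_eq_integral_toReal_smul₀ (aemeasurable_omega W μ N).ennreal_ofReal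
      (by simp)]
    refine integral_congr_ae ?_
    filter_upwards [h] with x hx
    have hp : 0 ≤ omega W μ N x := (omegaVal_pos (hc.trans_le hx)).le
    rw [ENNReal.toReal_ofReal hp, smul_eq_mul]
    congr 1
    exact mul_comm _ _

/-- The dual space `ℋ_N⁻¹` of bounded linear functionals on `ℋ_N`. -/
abbrev DualSpace {d : ℕ} {L : ℝ} [Fact (0 < L)] (W : C(Torus d L, ℝ)) (μ : ℝ)
    (N : Density d L) : Type :=
  StrongDual ℝ (PotentialSpace W μ N)

/-- The functional `F ∈ ℋ_{N₀}⁻¹` is (integration against) the `L¹` function `n`; the integral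
`∫ n ψ` is required to represent `F ψ` for every essentially bounded `ψ ∈ ℋ_{N₀}`. -/
def IsL1Function {d : ℕ} {L : ℝ} [Fact (0 < L)] {W : C(Torus d L, ℝ)} {μ : ℝ}
    {N₀ : Density d L} (F : DualSpace W μ N₀) (n : Torus d L → ℝ) : Prop :=
  Integrable n ∧ ∀ ψ : PotentialSpace W μ N₀,
    (∃ C : ℝ, ∀ᵐ x, |potential ψ x| ≤ C) → F ψ = ∫ x, n x * potential ψ x

/-- `𝒢_μ (n) = ∫ (n log n - [n + μ n]) dx + ½ ∫∫ W (x - y) n x n y dx dy` for an `L¹` function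
`n ≥ 0`, equal to `+∞` if `n log n` is not integrable. -/
def freeEnergy {d : ℕ} {L : ℝ} [Fact (0 < L)] (W : C(Torus d L, ℝ)) (μ : ℝ)
    (n : Torus d L → ℝ) : EReal :=
  open scoped Classical in
  if Integrable fun x => n x * Real.log (n x) then
    (((∫ x, (n x * Real.log (n x) - (n x + μ * n x)))
      + 1 / 2 * ∫ x, ∫ y, W (x - y) * n x * n y : ℝ) : EReal)
  else ⊤

/-- `𝒢_μ` on `ℋ_{N₀}⁻¹`: the value above if the functional is a nonnegative `L¹` function (which
is unique up to null sets), and `+∞` otherwise. -/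
def freeEnergyDual {d : ℕ} {L : ℝ} [Fact (0 < L)] {W : C(Torus d L, ℝ)} {μ : ℝ}
    {N₀ : Density d L} (F : DualSpace W μ N₀) : EReal :=
  ⨅ (n : Torus d L → ℝ) (_ : IsL1Function F n ∧ ∀ᵐ x, 0 ≤ n x), freeEnergy W μ n

/-- The (time dependent) field `φ ∈ L²((0, h); ℋ_{N₀})` drives `N₀` at time `0` to `F` at time `h`
under the linearized dynamics `∂N_t/∂t = ∇ · (N₀ ∇φ_t) - Ω_{N₀} φ_t`, understood weakly:
`N_t[ψ] = ∫ N₀ ψ dx - ∫₀ᵗ ⟪φ_s, ψ⟫ ds` for all `ψ ∈ ℋ_{N₀}`. -/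
def Drives {d : ℕ} {L : ℝ} [Fact (0 < L)] {W : C(Torus d L, ℝ)} {μ : ℝ} {N₀ : Density d L}
    (h : ℝ) (φ : ℝ → PotentialSpace W μ N₀) (F : DualSpace W μ N₀) : Prop :=
  MemLp φ 2 (volume.restrict (Ioc 0 h)) ∧
  ∃ N : ℝ → DualSpace W μ N₀, N h = F ∧
    ∀ t ∈ Icc 0 h, ∀ ψ : PotentialSpace W μ N₀,
      N t ψ = (∫ x, N₀.toFun x * potential ψ x) - ∫ s in (0 : ℝ)..t, inner ℝ (φ s) ψ

/-- The squared approximate distance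
`D_A² (N₀, F) = inf h ∫₀ʰ ⟪φ_t, φ_t⟫ dt`, over the fields driving `N₀` to `F` in time `h`. -/
def distSq {d : ℕ} {L : ℝ} [Fact (0 < L)] {W : C(Torus d L, ℝ)} {μ : ℝ} {N₀ : Density d L}
    (h : ℝ) (F : DualSpace W μ N₀) : ℝ≥0∞ :=
  ⨅ (φ : ℝ → PotentialSpace W μ N₀) (_ : Drives h φ F),
    ENNReal.ofReal h * ∫⁻ t in Ioc 0 h, ENNReal.ofReal (inner ℝ (φ t) (φ t))

/-- The approximate JKO functional `J_A (N₀, ·) = ½ D_A² (N₀, ·) + h 𝒢_μ` on `ℋ_{N₀}⁻¹`. -/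
def approxJKO {d : ℕ} {L : ℝ} [Fact (0 < L)] (W : C(Torus d L, ℝ)) (μ h : ℝ) (N₀ : Density d L)
    (F : DualSpace W μ N₀) : EReal :=
  ((1 / 2 * distSq h F : ℝ≥0∞) : EReal) + (h : EReal) * freeEnergyDual F

end

end GrandCanonical

open Filter Topology

/-! The coefficients of the dynamics are frozen at `N₀`, so the endpoint depends on the driving
field only through its time integral. By Riesz and Cauchy–Schwarz, a field constant in time is
optimal, and `distSq h F` equals `‖F₀ - F‖ ^ 2` in the dual norm, where `F₀` is integration against
`N₀` (`distSq_eq`). This needs the potential space to be complete and `N₀` to act boundedly on it;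
both follow from the positive lower bounds on `N₀` and `Ω`.

What remains is the direct method for `1/2 * ‖F₀ - F‖ ^ 2` plus `h` times entropy and interaction.
H-stability makes the interaction nonnegative, so a minimizing sequence has bounded entropy and
bounded dual norm. Bounded entropy gives uniform integrability, hence a weak `L¹` limit of the
densities; bounded norm gives a weak-* limit of the functionals. Both limits are taken along the
same ultrafilter, and testing against bounded potentials shows that the limit density represents the
limit functional. Norm and entropy are lower semicontinuous and the interaction is continuous
(`tendsto_interaction`), so the limit is a minimizer. The value at `N₀` is finite, which forces
every minimizer to have finite value and to be a nonnegative `L¹` function. -/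

/-- Young's inequality for the conjugate pair `a log a - a` and `exp`: it is `x + 1 ≤ exp x` at `x =
v - log a`, multiplied by `a`. All entropy estimates below come from choices of `v`. -/
theorem mul_le_mul_log_sub_add_exp {a : ℝ} (ha : 0 ≤ a) (v : ℝ) :
    a * v ≤ a * Real.log a - a + Real.exp v := by
  rcases ha.eq_or_lt with rfl | ha
  · simpa using (Real.exp_pos v).le
  · have h1 := Real.add_one_le_exp (v - Real.log a)
    have h2 : Real.exp v = a * Real.exp (v - Real.log a) := by
      rw [Real.exp_sub, Real.exp_log ha]
      field_simp
    rw [h2]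
    nlinarith

/-! ### Weak `L¹` compactness -/

/-- By compactness of `[0, ∞]`, the values on every set converge along the ultrafilter, with no
extraction of subsequences. Finite additivity passes to the limit; uniform absolute continuity gives
continuity at `∅`, hence countable additivity. -/
theorem exists_measure_tendsto_ultrafilter {X ι : Type*} [MeasurableSpace X] (U : Ultrafilter ι)
    (ν : Measure X) [IsFiniteMeasure ν] (κ : ι → Measure X)
    (hui : ∀ ε : ℝ≥0∞, 0 < ε → ∃ δ : ℝ≥0∞, 0 < δ ∧
      ∀ A, MeasurableSet A → ν A ≤ δ → ∀ k, κ k A ≤ ε)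
    (M : ℝ≥0∞) (hM : M ≠ ⊤) (hmass : ∀ k, κ k univ ≤ M) :
    ∃ m : Measure X, m univ ≤ M ∧ m ≪ ν ∧
      ∀ A, MeasurableSet A → Tendsto (fun k => κ k A) U (𝓝 (m A)) := by
  have hlim : ∀ A : Set X, ∃ a : ℝ≥0∞, Tendsto (fun k => κ k A) U (𝓝 a) := fun A =>
    ⟨_, Ultrafilter.le_nhds_lim (U.map fun k => κ k A)⟩
  choose c hc using hlim
  have hle : ∀ A a, (∀ k, κ k A ≤ a) → c A ≤ a := fun A a h =>
    le_of_tendsto (hc A) (Eventually.of_forall h)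
  have hcM : ∀ A, c A ≤ M := fun A => hle A M fun k => (measure_mono (subset_univ A)).trans (hmass k)
  have h0 : c ∅ = 0 := by
    have := hle ∅ 0 (by simp)
    simpa using this
  have hring : IsSetRing {A : Set X | MeasurableSet A} :=
    { empty_mem := MeasurableSet.empty
      union_mem := fun _ _ h h' => MeasurableSet.union h h'
      sdiff_mem := fun _ _ h h' => MeasurableSet.diff h h' }
  have hunion : ∀ A B, MeasurableSet A → MeasurableSet B → Disjoint A B →
      c (A ∪ B) = c A + c B := by
    intro A B _ hB hAB
    refine tendsto_nhds_unique (hc (A ∪ B)) ?_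
    simp_rw [measure_union hAB hB]
    exact (hc A).add (hc B)
  let m0 : AddContent ℝ≥0∞ {A : Set X | MeasurableSet A} :=
    hring.addContent_of_union c h0 fun hA hB hd => hunion _ _ hA hB hd
  have hcont : ∀ ⦃s : ℕ → Set X⦄, (∀ n, s n ∈ {A : Set X | MeasurableSet A}) → Antitone s →
      ⋂ n, s n = ∅ → Tendsto (fun n => m0 (s n)) atTop (𝓝 0) := by
    intro s hs hanti hempty
    have hν : Tendsto (fun n => ν (s n)) atTop (𝓝 0) := by
      have := tendsto_measure_iInter_atTop (μ := ν) (fun n => (hs n).nullMeasurableSet) hanti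
        ⟨0, measure_ne_top _ _⟩
      rw [hempty, measure_empty] at this
      exact this
    rw [ENNReal.tendsto_nhds_zero]
    intro ε hε
    obtain ⟨δ, hδ, h⟩ := hui ε hε
    filter_upwards [ENNReal.tendsto_nhds_zero.1 hν δ hδ] with n hn
    exact hle _ _ (h _ (hs n) hn)
  have hσ : ∀ ⦃f : ℕ → Set X⦄, (∀ i, MeasurableSet (f i)) → Pairwise (Function.onFun Disjoint f) →
      c (⋃ i, f i) = ∑' i, c (f i) := by
    intro f hf hd
    exact addContent_iUnion_eq_sum_of_tendsto_zero hring m0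
      (fun A _ => ((hcM A).trans_lt hM.lt_top).ne) hcont hf (MeasurableSet.iUnion hf) hd
  let m : Measure X := Measure.ofMeasurable (fun A _ => c A) h0 fun f hf hd => hσ hf hd
  have hm : ∀ A, MeasurableSet A → m A = c A := fun A hA => Measure.ofMeasurable_apply A hA
  refine ⟨m, ?_, ?_, ?_⟩
  · rw [hm _ MeasurableSet.univ]
    exact hcM _
  · refine Measure.AbsolutelyContinuous.mk fun A hA hA0 => ?_
    rw [hm A hA]
    refine le_antisymm (le_of_forall_gt fun ε hε => ?_) zero_le
    obtain ⟨ε', hε', hlt⟩ := exists_between hε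
    obtain ⟨δ, _, h⟩ := hui ε' hε'
    exact (hle _ _ (h A hA (by simp [hA0]))).trans_lt hlt
  · intro A hA
    rw [hm A hA]
    exact hc A

theorem exists_simpleFunc_dist_le {X : Type*} [MeasurableSpace X] {ψ : X → ℝ} (hψ : Measurable ψ)
    {C : ℝ} (hC : ∀ x, |ψ x| ≤ C) {ε : ℝ} (hε : 0 < ε) :
    ∃ s : SimpleFunc X ℝ, ∀ x, |ψ x - s x| ≤ ε := by
  -- Round down to the grid of mesh `ε`; boundedness leaves finitely many grid points.
  refine ⟨⟨fun x => ε * (⌊ψ x / ε⌋ : ℝ), fun y => ?_, ?_⟩, fun x => ?_⟩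
  · exact (by fun_prop : Measurable fun x => ε * (⌊ψ x / ε⌋ : ℝ)) (measurableSet_singleton y)
  · refine ((Set.finite_Icc ⌊-C / ε⌋ ⌊C / ε⌋).image fun z : ℤ => ε * (z : ℝ)).subset ?_
    rintro _ ⟨x, rfl⟩
    have := abs_le.1 (hC x)
    refine ⟨⌊ψ x / ε⌋, ⟨Int.floor_le_floor ?_, Int.floor_le_floor ?_⟩, rfl⟩ <;> gcongr <;> tauto
  · change |ψ x - ε * (⌊ψ x / ε⌋ : ℝ)| ≤ ε
    have h1 := Int.floor_le (ψ x / ε)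
    have h2 := (Int.lt_floor_add_one (ψ x / ε)).le
    rw [le_div_iff₀ hε] at h1
    rw [div_le_iff₀ hε] at h2
    rw [abs_le]
    constructor <;> nlinarith

theorem tendsto_integral_of_tendsto_measure {X ι : Type*} [MeasurableSpace X] {l : Filter ι}
    {κ : ι → Measure X} [∀ k, IsFiniteMeasure (κ k)] {m : Measure X} [IsFiniteMeasure m] {M : ℝ}
    (hM : ∀ k, (κ k).real univ ≤ M) (hm : m.real univ ≤ M)
    (h : ∀ A, MeasurableSet A → Tendsto (fun k => (κ k).real A) l (𝓝 (m.real A)))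
    {ψ : X → ℝ} (hψ : Measurable ψ) {C : ℝ} (hC : ∀ x, |ψ x| ≤ C) :
    Tendsto (fun k => ∫ x, ψ x ∂κ k) l (𝓝 (∫ x, ψ x ∂m)) := by
  have hM0 : 0 ≤ M := measureReal_nonneg.trans hm
  rw [Metric.tendsto_nhds]
  intro ε hε
  -- Two approximation errors and the simple-function error cost `ε / 4` each; `M + 1` avoids
  -- dividing by zero.
  obtain ⟨s, hs⟩ := exists_simpleFunc_dist_le hψ hC (ε := ε / (4 * (M + 1))) (by positivity)
  have key : ∀ ρ : Measure X, IsFiniteMeasure ρ → ρ.real univ ≤ M →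
      |∫ x, ψ x ∂ρ - ∫ x, s x ∂ρ| ≤ ε / 4 := by
    intro ρ _ hρ
    have i1 : Integrable ψ ρ := Integrable.of_bound hψ.aestronglyMeasurable C
      (Eventually.of_forall hC)
    have i2 : Integrable s ρ := s.integrable_of_isFiniteMeasure
    rw [← integral_sub i1 i2]
    refine (norm_integral_le_of_norm_le_const (f := fun x => ψ x - s x)
      (C := ε / (4 * (M + 1))) (Eventually.of_forall hs)).trans ?_
    calc ε / (4 * (M + 1)) * ρ.real univ ≤ ε / (4 * (M + 1)) * (M + 1) := by gcongr; linarith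
      _ = ε / 4 := by field_simp
  have hsl : Tendsto (fun k => ∫ x, s x ∂κ k) l (𝓝 (∫ x, s x ∂m)) := by
    have e : ∀ ρ : Measure X, IsFiniteMeasure ρ →
        ∫ x, s x ∂ρ = ∑ y ∈ s.range, ρ.real (s ⁻¹' {y}) • y := fun ρ _ =>
      (SimpleFunc.integral_eq_integral s s.integrable_of_isFiniteMeasure).symm.trans
        (SimpleFunc.integral_eq _ _)
    simp_rw [fun k => e (κ k) inferInstance, e m inferInstance]
    exact tendsto_finsetSum _ fun y _ => (h _ (s.measurableSet_fiber y)).smul_const y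
  filter_upwards [Metric.tendsto_nhds.1 hsl (ε / 4) (by positivity)] with k hk
  rw [Real.dist_eq] at hk ⊢
  have a1 := abs_le.1 (key (κ k) inferInstance (hM k))
  have a2 := abs_le.1 (key m inferInstance hm)
  have a3 := abs_lt.1 hk
  rw [abs_lt]
  constructor <;> linarith [a1.1, a1.2, a2.1, a2.2, a3.1, a3.2]

/-- Relative weak compactness in `L¹` of uniformly integrable families of densities. -/
theorem exists_weak_limit_of_unifIntegrable {X ι : Type*} [MeasurableSpace X] (U : Ultrafilter ι)
    {ν : Measure X} [IsFiniteMeasure ν] {n : ι → X → ℝ} (hn : ∀ k, Integrable (n k) ν)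
    (hpos : ∀ k, ∀ᵐ x ∂ν, 0 ≤ n k x)
    (hui : ∀ ε : ℝ, 0 < ε → ∃ δ : ℝ, 0 < δ ∧
      ∀ A, MeasurableSet A → ν.real A ≤ δ → ∀ k, ∫ x in A, n k x ∂ν ≤ ε)
    {M : ℝ} (hM : ∀ k, ∫ x, n k x ∂ν ≤ M) :
    ∃ f : X → ℝ, Integrable f ν ∧ (∀ x, 0 ≤ f x) ∧ ∀ ψ : X → ℝ, AEStronglyMeasurable ψ ν →
      ∀ C : ℝ, (∀ᵐ x ∂ν, |ψ x| ≤ C) →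
        Tendsto (fun k => ∫ x, n k x * ψ x ∂ν) U (𝓝 (∫ x, f x * ψ x ∂ν)) := by
  set κ : ι → Measure X := fun k => ν.withDensity fun x => ENNReal.ofReal (n k x) with hκ
  have hset : ∀ k A, MeasurableSet A → κ k A = ENNReal.ofReal (∫ x in A, n k x ∂ν) := by
    intro k A hA
    rw [hκ, withDensity_apply _ hA,
      ofReal_integral_eq_lintegral_ofReal (hn k).integrableOn (ae_restrict_of_ae (hpos k))]
  have hintmul : ∀ (k : ι) (ψ : X → ℝ), ∫ x, ψ x ∂κ k = ∫ x, n k x * ψ x ∂ν := by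
    intro k ψ
    rw [hκ, integral_withDensity_eq_integral_toReal_smul₀ (hn k).1.aemeasurable.ennreal_ofReal
      (by simp)]
    refine integral_congr_ae ?_
    filter_upwards [hpos k] with x hx
    rw [ENNReal.toReal_ofReal hx, smul_eq_mul]
  have hκM : ∀ k, κ k univ ≤ ENNReal.ofReal M := fun k => by
    rw [hset k _ MeasurableSet.univ, setIntegral_univ]
    exact ENNReal.ofReal_le_ofReal (hM k)
  have hfin : ∀ k, IsFiniteMeasure (κ k) := fun k => ⟨(hκM k).trans_lt ENNReal.ofReal_lt_top⟩
  obtain ⟨m, hmM, hmν, hm⟩ := exists_measure_tendsto_ultrafilter U ν κ (by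
    intro ε hε
    rcases eq_or_ne ε ⊤ with rfl | hε'
    · exact ⟨1, one_pos, by simp⟩
    obtain ⟨δ, hδ, h⟩ := hui ε.toReal (ENNReal.toReal_pos hε.ne' hε')
    refine ⟨ENNReal.ofReal δ, by simpa using hδ, fun A hA hAδ k => ?_⟩
    rw [hset k A hA, ENNReal.ofReal_le_iff_le_toReal hε']
    exact h A hA (ENNReal.toReal_le_of_le_ofReal hδ.le hAδ) k) _ ENNReal.ofReal_ne_top hκM
  have hmfin : IsFiniteMeasure m := ⟨hmM.trans_lt ENNReal.ofReal_lt_top⟩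
  have hrn : ∀ ψ : X → ℝ, ∫ x, ψ x ∂m = ∫ x, (m.rnDeriv ν x).toReal * ψ x ∂ν := by
    intro ψ
    simpa only [smul_eq_mul] using (integral_rnDeriv_smul hmν (f := ψ)).symm
  refine ⟨fun x => (m.rnDeriv ν x).toReal, Measure.integrable_toReal_rnDeriv,
    fun x => ENNReal.toReal_nonneg, fun ψ hψ C hC => ?_⟩
  obtain ⟨g, hg, hψg⟩ := hψ
  -- Clamping a measurable version of `ψ` makes the almost everywhere bound hold everywhere.
  have hg' : Measurable fun x => max (-C) (min C (g x)) := by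
    have := hg.measurable
    fun_prop
  have hae : (fun x => max (-C) (min C (g x))) =ᵐ[ν] ψ := by
    filter_upwards [hψg, hC] with x hx hxC
    rw [← hx, min_eq_right (abs_le.1 hxC).2, max_eq_right (abs_le.1 hxC).1]
  have hbd : ∀ x, |max (-C) (min C (g x))| ≤ |C| := fun x => by
    rw [abs_le]
    exact ⟨(neg_abs_le_neg C).trans (le_max_left _ _),
      max_le (neg_le_abs C) ((min_le_left _ _).trans (le_abs_self C))⟩
  have hT := tendsto_integral_of_tendsto_measure (l := (U : Filter ι)) (κ := κ) (m := m)
    (M := max M 0) (fun k => ?_) ?_ (fun A hA => ?_) hg' hbd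
  · have e1 : ∀ f : X → ℝ, ∫ x, f x * max (-C) (min C (g x)) ∂ν = ∫ x, f x * ψ x ∂ν := fun f =>
      integral_congr_ae (by filter_upwards [hae] with x hx; rw [hx])
    simp_rw [hintmul, hrn, e1] at hT
    exact hT
  · exact ENNReal.toReal_le_of_le_ofReal (le_max_right _ _)
      ((hκM k).trans (ENNReal.ofReal_le_ofReal (le_max_left _ _)))
  · exact ENNReal.toReal_le_of_le_ofReal (le_max_right _ _)
      (hmM.trans (ENNReal.ofReal_le_ofReal (le_max_left _ _)))
  · exact (ENNReal.tendsto_toReal (measure_ne_top m A)).comp (hm A hA)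

/-! ### Entropy: bounds and lower semicontinuity -/

theorem integrable_entropy {X : Type*} [MeasurableSpace X] {ν : Measure X} {n : X → ℝ}
    (hn : Integrable n ν) (hlog : Integrable (fun x => n x * Real.log (n x)) ν) (μ : ℝ) :
    Integrable (fun x => n x * Real.log (n x) - (n x + μ * n x)) ν :=
  hlog.sub (hn.add (hn.const_mul μ))

/-- Young's inequality with `v = μ + K` on `A` and `v = μ` off `A`. Large `K` yields uniform
integrability, `K = 1` a mass bound, `K = 0` a lower bound on the entropy. -/
theorem mul_setIntegral_le_entropy {X : Type*} [MeasurableSpace X] {ν : Measure X}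
    [IsFiniteMeasure ν] {n : X → ℝ} (hn : Integrable n ν) (hpos : ∀ᵐ x ∂ν, 0 ≤ n x)
    (hlog : Integrable (fun x => n x * Real.log (n x)) ν) (μ K : ℝ) {A : Set X}
    (hA : MeasurableSet A) :
    K * ∫ x in A, n x ∂ν ≤ ∫ x, (n x * Real.log (n x) - (n x + μ * n x)) ∂ν
      + Real.exp μ * ν.real univ + Real.exp (μ + K) * ν.real A := by
  have i1 : Integrable (fun x => n x * Real.log (n x) - (n x + μ * n x)) ν :=
    integrable_entropy hn hlog μ
  have i3 : Integrable (fun x => n x * Real.log (n x) - (n x + μ * n x) + Real.exp μ) ν :=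
    i1.add (integrable_const _)
  have i2 : Integrable (A.indicator fun _ => Real.exp (μ + K)) ν :=
    (integrable_const _).indicator hA
  calc K * ∫ x in A, n x ∂ν = ∫ x, K * A.indicator n x ∂ν := by
        rw [integral_const_mul, integral_indicator hA]
    _ ≤ ∫ x, ((n x * Real.log (n x) - (n x + μ * n x)) + Real.exp μ
          + A.indicator (fun _ => Real.exp (μ + K)) x) ∂ν := by
        refine integral_mono_ae ((hn.indicator hA).const_mul K)
          (i3.add i2) ?_
        filter_upwards [hpos] with x hx
        by_cases hxA : x ∈ A
        · have := mul_le_mul_log_sub_add_exp hx (μ + K)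
          simp only [indicator_of_mem hxA]
          linarith [Real.exp_pos μ]
        · have := mul_le_mul_log_sub_add_exp hx μ
          simp only [indicator_of_notMem hxA]
          linarith
    _ = _ := by
        rw [integral_add i3 i2, integral_add i1 (integrable_const _),
          integral_indicator hA]
        simp only [integral_const, smul_eq_mul, measureReal_restrict_apply_univ]
        ring

/-- A bound on the entropy yields uniform integrability. -/
theorem unifIntegrable_of_entropy_le {X ι : Type*} [MeasurableSpace X] {ν : Measure X}
    [IsFiniteMeasure ν] {n : ι → X → ℝ} (hn : ∀ k, Integrable (n k) ν)
    (hpos : ∀ k, ∀ᵐ x ∂ν, 0 ≤ n k x)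
    (hlog : ∀ k, Integrable (fun x => n k x * Real.log (n k x)) ν) {μ C : ℝ}
    (hC : ∀ k, ∫ x, (n k x * Real.log (n k x) - (n k x + μ * n k x)) ∂ν ≤ C) :
    ∀ ε : ℝ, 0 < ε → ∃ δ : ℝ, 0 < δ ∧
      ∀ A, MeasurableSet A → ν.real A ≤ δ → ∀ k, ∫ x in A, n k x ∂ν ≤ ε := by
  intro ε hε
  -- The final `1` pays for the exponential term on `A`, which the choice of `δ` below controls.
  -- Taking `K = B / ε` turns a bound by `B` into one by `ε`.
  set B : ℝ := |C| + Real.exp μ * ν.real univ + 1 with hB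
  have hB0 : 0 < B := by positivity
  refine ⟨(Real.exp (μ + B / ε))⁻¹, by positivity, fun A hA hAδ k => ?_⟩
  have h1 := mul_setIntegral_le_entropy (hn k) (hpos k) (hlog k) μ (B / ε) hA
  have h2 : Real.exp (μ + B / ε) * ν.real A ≤ 1 := by
    calc _ ≤ Real.exp (μ + B / ε) * (Real.exp (μ + B / ε))⁻¹ := by gcongr
      _ = 1 := mul_inv_cancel₀ (Real.exp_pos _).ne'
  have h3 : B / ε * ∫ x in A, n k x ∂ν ≤ B := by
    linarith [hC k, le_abs_self C]
  rw [div_mul_eq_mul_div, div_le_iff₀ hε] at h3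
  exact le_of_mul_le_mul_left h3 hB0

/-- Clamping to `[1/(j+1), j+1]` moves `a` towards `1`, so `(a - c) * log c ≥ 0` for the clamped
value `c`, and `c log c - c ≥ -1`. The bound is uniform in `j`, as Fatou's lemma requires. -/
theorem neg_one_le_clamp_entropy (a : ℝ) (j : ℕ) :
    -1 ≤ a * Real.log (max (1 / ((j : ℝ) + 1)) (min a (j + 1)))
      - max (1 / ((j : ℝ) + 1)) (min a (j + 1)) := by
  have hj : (1 : ℝ) ≤ (j : ℝ) + 1 := by
    have : (0 : ℝ) ≤ j := j.cast_nonneg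
    linarith
  have hj' : 1 / ((j : ℝ) + 1) ≤ 1 := by
    rw [div_le_one (by positivity)]
    exact hj
  set c := max (1 / ((j : ℝ) + 1)) (min a (j + 1)) with hc
  have hcpos : 0 < c := lt_of_lt_of_le (by positivity) (le_max_left _ _)
  have h1 : -1 ≤ c * Real.log c - c := by
    have := mul_le_mul_log_sub_add_exp hcpos.le 0
    simp at this
    linarith
  have h2 : c * Real.log c ≤ a * Real.log c := by
    rcases le_total 1 a with h | h
    · have hc1 : 1 ≤ c := (le_min h hj).trans (le_max_right _ _)
      exact mul_le_mul_of_nonneg_right (max_le (hj'.trans h) (min_le_left _ _)) (Real.log_nonneg hc1)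
    · have hc1 : c ≤ 1 := max_le hj' ((min_le_left _ _).trans h)
      have hac : a ≤ c := by
        refine le_trans ?_ (le_max_right _ _)
        exact le_min le_rfl (h.trans hj)
      exact mul_le_mul_of_nonpos_right hac (Real.log_nonpos hcpos.le hc1)
  linarith

theorem tendsto_clamp_entropy {a : ℝ} (ha : 0 ≤ a) :
    Tendsto (fun j : ℕ => a * Real.log (max (1 / ((j : ℝ) + 1)) (min a (j + 1)))
      - max (1 / ((j : ℝ) + 1)) (min a (j + 1))) atTop (𝓝 (a * Real.log a - a)) := by
  have h0 : Tendsto (fun j : ℕ => 1 / ((j : ℝ) + 1)) atTop (𝓝 0) :=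
    tendsto_one_div_add_atTop_nhds_zero_nat
  have h1 : Tendsto (fun j : ℕ => min a ((j : ℝ) + 1)) atTop (𝓝 a) := by
    refine tendsto_const_nhds.congr' ?_
    filter_upwards [eventually_ge_atTop ⌈a⌉₊] with j hj
    have : a ≤ j := (Nat.le_ceil a).trans (by exact_mod_cast hj)
    rw [min_eq_left (by linarith)]
  have hc : Tendsto (fun j : ℕ => max (1 / ((j : ℝ) + 1)) (min a ((j : ℝ) + 1))) atTop (𝓝 a) := by
    simpa [max_eq_right ha] using h0.max h1
  refine Tendsto.sub ?_ hc
  rcases ha.eq_or_lt with rfl | ha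
  -- At `a = 0` the factor `a` kills the logarithm, although `log` of the clamped value tends to
  -- `-∞`.
  · simp
  · exact ((Real.continuousAt_log ha.ne').tendsto.comp hc).const_mul a

/-- Lower semicontinuity of the entropy under weak `L¹` convergence. -/
theorem entropy_le_of_tendsto {X ι : Type*} [MeasurableSpace X] {ν : Measure X}
    [IsFiniteMeasure ν] {l : Filter ι} [l.NeBot] {n : ι → X → ℝ} (hn : ∀ k, Integrable (n k) ν)
    (hpos : ∀ k, ∀ᵐ x ∂ν, 0 ≤ n k x)
    (hlog : ∀ k, Integrable (fun x => n k x * Real.log (n k x)) ν) {f : X → ℝ}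
    (hf : Integrable f ν) (hfpos : ∀ x, 0 ≤ f x)
    (hlim : ∀ ψ : X → ℝ, AEStronglyMeasurable ψ ν → ∀ C : ℝ, (∀ᵐ x ∂ν, |ψ x| ≤ C) →
      Tendsto (fun k => ∫ x, n k x * ψ x ∂ν) l (𝓝 (∫ x, f x * ψ x ∂ν))) {μ e : ℝ}
    (he : Tendsto (fun k => ∫ x, (n k x * Real.log (n k x) - (n k x + μ * n k x)) ∂ν) l (𝓝 e)) :
    Integrable (fun x => f x * Real.log (f x)) ν ∧
      ∫ x, (f x * Real.log (f x) - (f x + μ * f x)) ∂ν ≤ e := by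
  -- The optimal test function in Young's inequality would be `log f`; clamping `f` makes it
  -- bounded, so that weak convergence applies.
  set c : ℕ → X → ℝ := fun j x => max (1 / ((j : ℝ) + 1)) (min (f x) (j + 1)) with hc
  have hcm : ∀ j, AEStronglyMeasurable (c j) ν := fun j =>
    (aemeasurable_const.max
      (hf.1.aemeasurable.min aemeasurable_const)).aestronglyMeasurable
  have hlow : ∀ (j : ℕ) x, 1 / ((j : ℝ) + 1) ≤ c j x := fun j x => le_max_left _ _
  have hcpos : ∀ j x, 0 < c j x := fun j x => lt_of_lt_of_le (by positivity) (hlow j x)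
  have hup : ∀ (j : ℕ) x, c j x ≤ (j : ℝ) + 1 := fun j x => max_le (by
    have h0 : (0 : ℝ) ≤ j := j.cast_nonneg
    rw [div_le_iff₀ (by positivity)]
    nlinarith) (min_le_right _ _)
  have hlm : ∀ j, AEStronglyMeasurable (fun x => Real.log (c j x)) ν := fun j =>
    (Real.measurable_log.comp_aemeasurable (hcm j).aemeasurable).aestronglyMeasurable
  have hlb : ∀ (j : ℕ) x, |Real.log (c j x)| ≤ Real.log ((j : ℝ) + 1) := fun j x => by
    rw [abs_le]
    refine ⟨?_, Real.log_le_log (hcpos j x) (hup j x)⟩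
    have := Real.log_le_log (by positivity) (hlow j x)
    rwa [one_div, Real.log_inv] at this
  have hci : ∀ j, Integrable (c j) ν := fun j =>
    Integrable.of_bound (hcm j) ((j : ℝ) + 1) (Eventually.of_forall fun x => by
      rw [Real.norm_of_nonneg (hcpos j x).le]
      exact hup j x)
  have hmi : ∀ (g : X → ℝ) (j : ℕ), Integrable g ν →
      Integrable (fun x => g x * Real.log (c j x)) ν := fun g j hg =>
    hg.mul_bdd (c := Real.log ((j : ℝ) + 1)) (hlm j) (Eventually.of_forall fun x => hlb j x)
  -- Young's inequality with `v = log (c j x)` is linear in `n k` on the left, so it survives the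
  -- weak limit.
  have hE : ∀ j, ∫ x, (f x * Real.log (c j x) - c j x) ∂ν ≤ e + μ * ∫ x, f x ∂ν := by
    intro j
    have t1 := hlim (fun x => Real.log (c j x)) (hlm j) _ (Eventually.of_forall (hlb j))
    have t2 := hlim (fun _ => (1 : ℝ)) aestronglyMeasurable_const 1 (by simp)
    simp only [mul_one] at t2
    rw [integral_sub (hmi f j hf) (hci j)]
    refine le_of_tendsto_of_tendsto (t1.sub_const (∫ x, c j x ∂ν)) (he.add (t2.const_mul μ))
      (Eventually.of_forall fun k => ?_)
    change ∫ x, n k x * Real.log (c j x) ∂ν - ∫ x, c j x ∂ν ≤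
      ∫ x, (n k x * Real.log (n k x) - (n k x + μ * n k x)) ∂ν + μ * ∫ x, n k x ∂ν
    rw [← integral_const_mul, ← integral_sub (hmi _ j (hn k)) (hci j),
      ← integral_add (integrable_entropy (hn k) (hlog k) μ) ((hn k).const_mul μ)]
    refine integral_mono_ae ((hmi _ j (hn k)).sub (hci j))
      ((integrable_entropy (hn k) (hlog k) μ).add ((hn k).const_mul μ)) ?_
    filter_upwards [hpos k] with x hx
    have := mul_le_mul_log_sub_add_exp hx (Real.log (c j x))
    rw [Real.exp_log (hcpos j x)] at this
    change n k x * Real.log (c j x) - c j x ≤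
      (n k x * Real.log (n k x) - (n k x + μ * n k x)) + μ * n k x
    linarith
  have hgi : ∀ j, Integrable (fun x => f x * Real.log (c j x) - c j x + 1) ν := fun j =>
    ((hmi f j hf).sub (hci j)).add (integrable_const _)
  have hmeas : AEStronglyMeasurable (fun x => f x * Real.log (f x) - f x + 1) ν := by
    have := hf.1.aemeasurable
    exact AEMeasurable.aestronglyMeasurable (by fun_prop)
  -- The clamping is removed by Fatou in `j`; adding `1` makes the integrands nonnegative.
  have hfatou : ∫⁻ x, ENNReal.ofReal (f x * Real.log (f x) - f x + 1) ∂ν ≤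
      ENNReal.ofReal (e + μ * ∫ x, f x ∂ν + ν.real univ) := by
    refine le_trans (le_of_eq_of_le (lintegral_congr fun x => ?_)
      (lintegral_liminf_le' (u := atTop) (f := fun (j : ℕ) x =>
        ENNReal.ofReal (f x * Real.log (c j x) - c j x + 1))
        fun j => (hgi j).1.aemeasurable.ennreal_ofReal)) ?_
    · refine (Tendsto.liminf_eq ?_).symm
      exact ENNReal.tendsto_ofReal ((tendsto_clamp_entropy (hfpos x)).add_const 1)
    · refine liminf_le_of_le (by isBoundedDefault) fun b hb => ?_
      obtain ⟨j, hj⟩ := hb.exists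
      refine hj.trans ?_
      rw [← ofReal_integral_eq_lintegral_ofReal (hgi j) (Eventually.of_forall fun x => by
        have := neg_one_le_clamp_entropy (f x) j
        change 0 ≤ f x * Real.log (c j x) - c j x + 1
        linarith)]
      refine ENNReal.ofReal_le_ofReal ?_
      have j1 : Integrable (fun x => f x * Real.log (c j x) - c j x) ν := (hmi f j hf).sub (hci j)
      rw [integral_add j1 (integrable_const _)]
      simpa using hE j
  have hnn : ∀ x, 0 ≤ f x * Real.log (f x) - f x + 1 := fun x => by
    have := mul_le_mul_log_sub_add_exp (hfpos x) 0
    simp only [mul_zero, Real.exp_zero] at this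
    linarith
  have hint : Integrable (fun x => f x * Real.log (f x) - f x + 1) ν :=
    (lintegral_ofReal_ne_top_iff_integrable hmeas (Eventually.of_forall hnn)).1
      (hfatou.trans_lt ENNReal.ofReal_lt_top).ne
  have hi2 : Integrable (fun x => f x * Real.log (f x)) ν := by
    refine ((hint.add hf).sub (integrable_const (1 : ℝ))).congr (Eventually.of_forall fun x => ?_)
    simp only [Pi.sub_apply, Pi.add_apply]
    ring
  refine ⟨hi2, ?_⟩
  rw [← ofReal_integral_eq_lintegral_ofReal hint (Eventually.of_forall hnn)] at hfatou
  -- Needed to return from `ENNReal.ofReal`, which truncates negative values.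
  have hpos' : 0 ≤ e + μ * ∫ x, f x ∂ν + ν.real univ := by
    have h1 := hE 0
    have h2 : -(1 : ℝ) * ν.real univ ≤ ∫ x, (f x * Real.log (c 0 x) - c 0 x) ∂ν := by
      have : ∫ _, (-1 : ℝ) ∂ν ≤ ∫ x, (f x * Real.log (c 0 x) - c 0 x) ∂ν :=
        integral_mono (integrable_const _) ((hmi f 0 hf).sub (hci 0)) fun x =>
          neg_one_le_clamp_entropy (f x) 0
      simpa using this
    linarith
  have h3 := (ENNReal.ofReal_le_ofReal_iff hpos').1 hfatou
  have h4 : ∫ x, (f x * Real.log (f x) - f x + 1) ∂ν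
      = ∫ x, (f x * Real.log (f x) - (f x + μ * f x)) ∂ν + μ * ∫ x, f x ∂ν + ν.real univ := by
    have : ∀ x, f x * Real.log (f x) - f x + 1
        = (f x * Real.log (f x) - (f x + μ * f x)) + μ * f x + 1 := fun x => by ring
    simp_rw [this]
    have j1 := integrable_entropy hf hi2 μ
    have j2 : Integrable (fun x => (f x * Real.log (f x) - (f x + μ * f x)) + μ * f x) ν :=
      j1.add (hf.const_mul μ)
    rw [integral_add j2 (integrable_const _), integral_add j1 (hf.const_mul μ), integral_const_mul]
    simp
  linarith

/-! ### Interaction energy -/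

theorem abs_integral_mul_sub_le {X : Type*} [MeasurableSpace X] {ν : Measure X} {n a b : X → ℝ}
    (hn : Integrable n ν) (hpos : ∀ᵐ x ∂ν, 0 ≤ n x) (ha : Integrable (fun x => n x * a x) ν)
    (hb : Integrable (fun x => n x * b x) ν) {ε M : ℝ} (hε : 0 ≤ ε) (hM : ∫ x, n x ∂ν ≤ M)
    (hab : ∀ x, |a x - b x| ≤ ε) :
    |∫ x, n x * a x ∂ν - ∫ x, n x * b x ∂ν| ≤ ε * M := by
  rw [← integral_sub ha hb]
  have : ‖∫ x, (n x * a x - n x * b x) ∂ν‖ ≤ ∫ x, ε * n x ∂ν := by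
    refine norm_integral_le_of_norm_le (hn.const_mul ε) ?_
    filter_upwards [hpos] with x hx
    rw [← mul_sub, norm_mul, Real.norm_of_nonneg hx, mul_comm]
    exact mul_le_mul_of_nonneg_right (hab x) hx
  rw [integral_const_mul] at this
  exact this.trans (mul_le_mul_of_nonneg_left hM hε)

/-- The interaction energy of a continuous kernel on a compact space is weakly continuous. -/
theorem tendsto_interaction {X ι : Type*} [PseudoMetricSpace X] [CompactSpace X]
    [MeasurableSpace X] [BorelSpace X] [SecondCountableTopology X]
    {ν : Measure X} [IsFiniteMeasure ν] {l : Filter ι} [l.NeBot] {K : X → X → ℝ}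
    (hK : Continuous fun p : X × X => K p.1 p.2) {n : ι → X → ℝ} (hn : ∀ k, Integrable (n k) ν)
    (hpos : ∀ k, ∀ᵐ x ∂ν, 0 ≤ n k x) {M : ℝ} (hM : ∀ k, ∫ x, n k x ∂ν ≤ M) {f : X → ℝ}
    (hf : Integrable f ν) (hfpos : ∀ x, 0 ≤ f x)
    (hlim : ∀ ψ : X → ℝ, AEStronglyMeasurable ψ ν → ∀ C : ℝ, (∀ᵐ x ∂ν, |ψ x| ≤ C) →
      Tendsto (fun k => ∫ x, n k x * ψ x ∂ν) l (𝓝 (∫ x, f x * ψ x ∂ν))) :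
    Tendsto (fun k => ∫ x, ∫ y, K x y * n k x * n k y ∂ν ∂ν) l
      (𝓝 (∫ x, ∫ y, K x y * f x * f y ∂ν ∂ν)) := by
  obtain ⟨C, hC⟩ : ∃ C, ∀ x y, |K x y| ≤ C := by
    obtain ⟨C, hC⟩ := (isCompact_range hK).isBounded.exists_norm_le
    exact ⟨C, fun x y => hC _ ⟨(x, y), rfl⟩⟩
  have hKx : ∀ x, Continuous (K x) := fun x => hK.comp (by fun_prop : Continuous fun y => (x, y))
  have hKi : ∀ (g : X → ℝ) x, Integrable g ν → Integrable (fun y => g y * K x y) ν := fun g x hg =>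
    hg.mul_bdd (c := C) (hKx x).aestronglyMeasurable (Eventually.of_forall (hC x))
  have hrw : ∀ g : X → ℝ, ∫ x, ∫ y, K x y * g x * g y ∂ν ∂ν = ∫ x, g x * ∫ y, g y * K x y ∂ν ∂ν := by
    intro g
    refine integral_congr_ae (Eventually.of_forall fun x => ?_)
    simp only [← integral_const_mul]
    exact integral_congr_ae (Eventually.of_forall fun y => by simp only; ring)
  have hpm : ∀ g : X → ℝ, Integrable g ν →
      AEStronglyMeasurable (fun x => ∫ y, g y * K x y ∂ν) ν := fun g hg =>
    AEStronglyMeasurable.integral_prod_right' (f := fun p : X × X => g p.2 * K p.1 p.2)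
      (hg.1.comp_snd.mul hK.aestronglyMeasurable)
  have hfM : ∫ x, f x ∂ν ≤ M := by
    have := hlim (fun _ => 1) aestronglyMeasurable_const 1 (by simp)
    simp only [mul_one] at this
    exact le_of_tendsto this (Eventually.of_forall hM)
  have hM0 : 0 ≤ M := (integral_nonneg hfpos).trans hfM
  rcases isEmpty_or_nonempty X with hX | ⟨⟨x₀⟩⟩
  · simp [Measure.eq_zero_of_isEmpty ν]
  have hC0 : 0 ≤ C := (abs_nonneg _).trans (hC x₀ x₀)
  have hpb : ∀ g : X → ℝ, Integrable g ν → (∀ᵐ x ∂ν, 0 ≤ g x) → ∫ x, g x ∂ν ≤ M →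
      ∀ x, |∫ y, g y * K x y ∂ν| ≤ C * M := by
    intro g hg hg0 hgM x
    have := abs_integral_mul_sub_le (b := fun _ => 0) hg hg0 (hKi g x hg) (by simp) hC0 hgM
      (fun y => by simpa using hC x y)
    simpa using this
  have hpi : ∀ g g' : X → ℝ, Integrable g ν → (∀ᵐ x ∂ν, 0 ≤ g x) → ∫ x, g x ∂ν ≤ M →
      Integrable g' ν → Integrable (fun x => g' x * ∫ y, g y * K x y ∂ν) ν :=
    fun g g' hg hg0 hgM hg' => hg'.mul_bdd (c := C * M) (hpm g hg)
      (Eventually.of_forall (hpb g hg hg0 hgM))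
  -- Potentials converge uniformly: the mass bound and uniform continuity of `K` make them
  -- equicontinuous, so convergence on a finite net suffices.
  have hunif : ∀ ε : ℝ, 0 < ε → ∀ᶠ k in l, ∀ x,
      |∫ y, n k y * K x y ∂ν - ∫ y, f y * K x y ∂ν| ≤ ε := by
    intro ε hε
    have huc := CompactSpace.uniformContinuous_of_continuous hK
    obtain ⟨δ, hδ, h⟩ := Metric.uniformContinuous_iff.1 huc (ε / (3 * (M + 1))) (by positivity)
    obtain ⟨t, -, htf, htc⟩ := finite_cover_balls_of_compact (isCompact_univ (X := X)) hδ
    have hev : ∀ᶠ k in l, ∀ z ∈ t, |∫ y, n k y * K z y ∂ν - ∫ y, f y * K z y ∂ν| < ε / 3 := by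
      rw [Filter.eventually_all_finite htf]
      intro z _
      exact Metric.tendsto_nhds.1 (hlim (K z) (hKx z).aestronglyMeasurable C
        (Eventually.of_forall (hC z))) (ε / 3) (by positivity)
    filter_upwards [hev] with k hk x
    obtain ⟨z, hz, hxz⟩ := mem_iUnion₂.1 (htc (mem_univ x))
    have hd : ∀ y, |K x y - K z y| ≤ ε / (3 * (M + 1)) := fun y =>
      (h (a := (x, y)) (b := (z, y)) (by simpa [Prod.dist_eq, hδ] using hxz)).le
    have hM1 : ε / (3 * (M + 1)) * M ≤ ε / 3 := by
      calc _ ≤ ε / (3 * (M + 1)) * (M + 1) := by gcongr; linarith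
        _ = ε / 3 := by field_simp
    have a1 := (abs_integral_mul_sub_le (hn k) (hpos k) (hKi _ x (hn k)) (hKi _ z (hn k))
      (by positivity) (hM k) hd).trans hM1
    have a2 := (abs_integral_mul_sub_le hf (Eventually.of_forall hfpos) (hKi _ x hf) (hKi _ z hf)
      (by positivity) hfM hd).trans hM1
    have a3 := (hk z hz).le
    rw [abs_le] at a1 a2 a3 ⊢
    constructor <;> linarith [a1.1, a1.2, a2.1, a2.2, a3.1, a3.2]
  simp_rw [hrw]
  have t1 := hlim _ (hpm f hf) _ (Eventually.of_forall
    (hpb f hf (Eventually.of_forall hfpos) hfM))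
  -- The product of two weakly convergent factors is split: replacing the potential of `n k` by that
  -- of `f` costs a uniformly small error, and `t1` handles the fixed potential.
  have t2 : Tendsto (fun k => ∫ x, n k x * ∫ y, n k y * K x y ∂ν ∂ν
      - ∫ x, n k x * ∫ y, f y * K x y ∂ν ∂ν) l (𝓝 0) := by
    rw [Metric.tendsto_nhds]
    intro ε hε
    filter_upwards [hunif (ε / (2 * (M + 1))) (by positivity)] with k hk
    rw [Real.dist_eq, sub_zero]
    refine (abs_integral_mul_sub_le (hn k) (hpos k) (hpi _ _ (hn k) (hpos k) (hM k) (hn k))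
      (hpi _ _ hf (Eventually.of_forall hfpos) hfM (hn k)) (by positivity) (hM k) hk).trans_lt ?_
    calc _ ≤ ε / (2 * (M + 1)) * (M + 1) := by gcongr; linarith
      _ = ε / 2 := by field_simp
      _ < ε := by linarith
  simpa using t2.add t1

/-! ### The Hilbert space of potentials -/

/-- The representer is `b / ρ`, whose denominator cancels the weight; `hbi` says that it is square
integrable for `ρ dν`. -/
theorem exists_Lp_inner_eq_integral {X E : Type*} [MeasurableSpace X] [NormedAddCommGroup E]
    [InnerProductSpace ℝ E] {ν : Measure X} {ρ : X → ℝ} (hρ : AEMeasurable ρ ν)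
    (hpos : ∀ᵐ x ∂ν, 0 < ρ x) {b : X → E} (hb : AEStronglyMeasurable b ν)
    (hbi : Integrable (fun x => ‖b x‖ ^ 2 / ρ x) ν) :
    ∃ B : Lp E 2 (ν.withDensity fun x => ENNReal.ofReal (ρ x)),
      ∀ φ : Lp E 2 (ν.withDensity fun x => ENNReal.ofReal (ρ x)),
        inner ℝ B φ = ∫ x, inner ℝ (b x) (φ x) ∂ν := by
  have hac : (ν.withDensity fun x => ENNReal.ofReal (ρ x)) ≪ ν :=
    withDensity_absolutelyContinuous _ _
  have hm : AEStronglyMeasurable (fun x => (ρ x)⁻¹ • b x) ν :=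
    hρ.inv.aestronglyMeasurable.smul hb
  have hL : MemLp (fun x => (ρ x)⁻¹ • b x) 2 (ν.withDensity fun x => ENNReal.ofReal (ρ x)) := by
    rw [memLp_two_iff_integrable_sq_norm (hm.mono_ac hac),
      integrable_withDensity_iff_integrable_smul₀' hρ.ennreal_ofReal (by simp)]
    refine hbi.congr ?_
    filter_upwards [hpos] with x hx
    rw [ENNReal.toReal_ofReal hx.le, norm_smul, mul_pow, norm_inv, Real.norm_of_nonneg hx.le,
      smul_eq_mul]
    field_simp
  refine ⟨hL.toLp _, fun φ => ?_⟩
  rw [L2.inner_def, integral_congr_ae (g := fun x => inner ℝ ((ρ x)⁻¹ • b x) (φ x))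
    (by filter_upwards [hL.coeFn_toLp] with x hx; rw [hx]),
    integral_withDensity_eq_integral_toReal_smul₀ hρ.ennreal_ofReal (by simp)]
  refine integral_congr_ae ?_
  filter_upwards [hpos] with x hx
  rw [ENNReal.toReal_ofReal hx.le, real_inner_smul_left, smul_eq_mul, ← mul_assoc,
    mul_inv_cancel₀ hx.ne', one_mul]

theorem integrable_of_memLp_two_withDensity {X E : Type*} [MeasurableSpace X]
    [NormedAddCommGroup E] {ν : Measure X} [IsFiniteMeasure ν] {ρ : X → ℝ} {c : ℝ} (hc : 0 < c)
    (hρ : ∀ᵐ x ∂ν, c ≤ ρ x) {φ : X → E}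
    (hφ : MemLp φ 2 (ν.withDensity fun x => ENNReal.ofReal (ρ x))) : Integrable φ ν := by
  refine MemLp.integrable (q := 2) (by norm_num) (hφ.of_measure_le_smul
    (c := (ENNReal.ofReal c)⁻¹) (by simpa using hc) ?_)
  refine Measure.le_iff.2 fun A hA => ?_
  rw [Measure.smul_apply, withDensity_apply _ hA, smul_eq_mul]
  have h1 : ENNReal.ofReal c * ν A ≤ ∫⁻ x in A, ENNReal.ofReal (ρ x) ∂ν := by
    rw [← setLIntegral_const]
    refine lintegral_mono_ae (ae_restrict_of_ae ?_)
    filter_upwards [hρ] with x hx using ENNReal.ofReal_le_ofReal hx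
  calc ν A = (ENNReal.ofReal c)⁻¹ * (ENNReal.ofReal c * ν A) := by
        rw [← mul_assoc, ENNReal.inv_mul_cancel (by simpa using hc) ENNReal.ofReal_ne_top, one_mul]
    _ ≤ _ := by gcongr

namespace GrandCanonical

/-- The logarithmic mean dominates the geometric mean. -/
theorem sqrt_le_omegaVal {μ n w : ℝ} (hn : 0 < n) : √n ≤ omegaVal μ n w := by
  unfold omegaVal
  split_ifs with h
  · exact le_rfl
  set a := Real.log n - μ + w with ha
  have hs : √n = Real.exp (Real.log n / 2) := by
    rw [Real.sqrt_eq_rpow, Real.rpow_def_of_pos hn]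
    ring_nf
  -- Thus `Ω = √n * sinh (a / 2) / (a / 2)`, and `sinh x / x ≥ 1`.
  have e : n * Real.exp (-(1 / 2) * (μ - w)) - Real.exp (1 / 2 * (μ - w))
      = √n * (2 * Real.sinh (a / 2)) := by
    have e1 : n * Real.exp (-(1 / 2) * (μ - w)) = √n * Real.exp (a / 2) := by
      conv_lhs => rw [← Real.exp_log hn]
      rw [hs, ← Real.exp_add, ← Real.exp_add, ha]
      ring_nf
    have e2 : Real.exp (1 / 2 * (μ - w)) = √n * Real.exp (-(a / 2)) := by
      rw [hs, ← Real.exp_add, ha]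
      ring_nf
    rw [e1, e2, Real.sinh_eq]
    ring
  rw [e, mul_div_assoc]
  refine le_mul_of_one_le_right (Real.sqrt_nonneg n) ?_
  rcases lt_or_gt_of_ne h with h' | h'
  · rw [one_le_div_of_neg h']
    have := Real.sinh_le_self_iff.2 (by linarith : a / 2 ≤ 0)
    linarith
  · rw [one_le_div h']
    have := Real.self_le_sinh_iff.2 (by linarith : 0 ≤ a / 2)
    linarith

theorem exists_le_omega {d : ℕ} {L : ℝ} [Fact (0 < L)] (W : C(Torus d L, ℝ)) (μ : ℝ)
    (N : Density d L) : ∃ c : ℝ, 0 < c ∧ ∀ᵐ x, c ≤ omega W μ N x := by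
  obtain ⟨c, hc, h⟩ := N.bounded_below
  refine ⟨√c, Real.sqrt_pos.2 hc, ?_⟩
  filter_upwards [h] with x hx
  exact (Real.sqrt_le_sqrt hx).trans (sqrt_le_omegaVal (hc.trans_le hx))

theorem integrable_bounded_sq_div {X E : Type*} [MeasurableSpace X] [NormedAddCommGroup E]
    {ν : Measure X} [IsFiniteMeasure ν] {ρ : X → ℝ} (hρ : AEMeasurable ρ ν) {c : ℝ} (hc : 0 < c)
    (h : ∀ᵐ x ∂ν, c ≤ ρ x) {b : X → E} (hb : AEStronglyMeasurable b ν) {C : ℝ}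
    (hC : ∀ x, ‖b x‖ ≤ C) : Integrable (fun x => ‖b x‖ ^ 2 / ρ x) ν := by
  refine Integrable.of_bound
    ((hb.norm.aemeasurable.pow_const 2).div hρ).aestronglyMeasurable (C ^ 2 / c) ?_
  filter_upwards [h] with x hx
  have : 0 < ρ x := hc.trans_le hx
  rw [Real.norm_of_nonneg (by positivity)]
  have := hC x
  gcongr

/-- Integrability is automatic since both weights are bounded below, and each integration by parts
identity equates two continuous functionals. The resulting completeness is what Riesz representation
needs. -/
theorem isClosed_potentialSpace {d : ℕ} {L : ℝ} [Fact (0 < L)] (W : C(Torus d L, ℝ)) (μ : ℝ)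
    (N : Density d L) : IsClosed (PotentialSpace W μ N : Set (WithLp 2
      (Lp ℝ 2 (omegaMeasure W μ N) × Lp (Vec d) 2 (densityMeasure N)))) := by
  obtain ⟨c, hc, hcN⟩ := N.bounded_below
  obtain ⟨c', hc', hcΩ⟩ := exists_le_omega W μ N
  have hset : (PotentialSpace W μ N : Set (WithLp 2
      (Lp ℝ 2 (omegaMeasure W μ N) × Lp (Vec d) 2 (densityMeasure N)))) =
      ⋂ (η : Torus d L → ℝ) (_ : IsSmooth η) (i : Fin d),
        {p | ∫ x, p.fst x * partialDeriv i η x = -∫ x, p.snd x i * η x} := by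
    ext p
    simp only [mem_iInter, mem_ofPred_eq]
    exact ⟨fun h => h.parts, fun h =>
      ⟨integrable_of_memLp_two_withDensity hc' hcΩ (Lp.memLp p.fst),
        integrable_of_memLp_two_withDensity hc hcN (Lp.memLp p.snd), h⟩⟩
  rw [hset]
  refine isClosed_iInter fun η => isClosed_iInter fun hη => isClosed_iInter fun i => ?_
  obtain ⟨C₁, hC₁⟩ := (isCompact_range (hη.continuous_partialDeriv i)).isBounded.exists_norm_le
  obtain ⟨C₂, hC₂⟩ := (isCompact_range hη.continuous).isBounded.exists_norm_le
  have hb₁ := (hη.continuous_partialDeriv i).aestronglyMeasurable (μ := volume)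
  have hb₂ : AEStronglyMeasurable
      (fun x => EuclideanSpace.single i (η x) : Torus d L → Vec d) volume := by
    have : (fun x => EuclideanSpace.single i (η x) : Torus d L → Vec d)
        = fun x => η x • EuclideanSpace.single i (1 : ℝ) := by
      funext x
      ext j
      simp
    rw [this]
    exact (hη.continuous.smul continuous_const).aestronglyMeasurable
  obtain ⟨B₁, hB₁⟩ := exists_Lp_inner_eq_integral (aemeasurable_omega W μ N)
    (by filter_upwards [hcΩ] with x hx using hc'.trans_le hx) hb₁
    (integrable_bounded_sq_div (aemeasurable_omega W μ N) hc' hcΩ hb₁ fun x => hC₁ _ ⟨x, rfl⟩)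
  obtain ⟨B₂, hB₂⟩ := exists_Lp_inner_eq_integral N.memLp.1.aemeasurable
    (by filter_upwards [hcN] with x hx using hc.trans_le hx) hb₂
    (integrable_bounded_sq_div N.memLp.1.aemeasurable hc hcN hb₂ (C := C₂) fun x => by
      rw [PiLp.norm_single]
      exact hC₂ _ ⟨x, rfl⟩)
  have e₁ : ∀ p : WithLp 2 (Lp ℝ 2 (omegaMeasure W μ N) × Lp (Vec d) 2 (densityMeasure N)),
      ∫ x, p.fst x * partialDeriv i η x = inner ℝ B₁ p.fst := fun p => (hB₁ p.fst).symm
  have e₂ : ∀ p : WithLp 2 (Lp ℝ 2 (omegaMeasure W μ N) × Lp (Vec d) 2 (densityMeasure N)),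
      ∫ x, p.snd x i * η x = inner ℝ B₂ p.snd := fun p => by
    refine Eq.trans (integral_congr_ae (Eventually.of_forall fun x => ?_)) (hB₂ p.snd).symm
    exact (mul_comm _ _).trans (EuclideanSpace.inner_single_left (𝕜 := ℝ) i (η x) _).symm
  simp_rw [e₁, e₂]
  exact isClosed_eq (continuous_const.inner (WithLp.continuous_fst ..))
    (continuous_const.inner (WithLp.continuous_snd ..)).neg

instance completeSpace_potentialSpace {d : ℕ} {L : ℝ} [Fact (0 < L)] (W : C(Torus d L, ℝ)) (μ : ℝ) (N : Density d L) :
    CompleteSpace (PotentialSpace W μ N) :=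
  (isClosed_potentialSpace W μ N).completeSpace_coe

theorem exists_dual_density {d : ℕ} {L : ℝ} [Fact (0 < L)] (W : C(Torus d L, ℝ)) (μ : ℝ)
    (N : Density d L) : ∃ F : DualSpace W μ N, ∀ ψ : PotentialSpace W μ N,
      F ψ = ∫ x, N.toFun x * potential ψ x := by
  obtain ⟨c, hc, hcN⟩ := N.bounded_below
  have hΩ : ∀ᵐ x, √c ≤ omega W μ N x ∧ √(N.toFun x) ≤ omega W μ N x := by
    filter_upwards [hcN] with x hx
    have := sqrt_le_omegaVal (μ := μ) (w := convPot W N.toFun x) (hc.trans_le hx)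
    exact ⟨(Real.sqrt_le_sqrt hx).trans this, this⟩
  have hsq : Integrable fun x => N.toFun x ^ 2 := N.memLp.integrable_sq
  -- This is where `N ∈ L²` enters, together with `Ω ≥ √c`.
  have hi : Integrable fun x => ‖N.toFun x‖ ^ 2 / omega W μ N x := by
    refine Integrable.mono' (hsq.div_const √c) ((N.memLp.1.norm.aemeasurable.pow_const 2).div
      (aemeasurable_omega W μ N)).aestronglyMeasurable ?_
    filter_upwards [hΩ] with x hx
    have h0 : 0 < √c := Real.sqrt_pos.2 hc
    have h1 : 0 < omega W μ N x := h0.trans_le hx.1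
    rw [Real.norm_of_nonneg (by positivity), Real.norm_eq_abs, sq_abs]
    have := hx.1
    gcongr
  obtain ⟨B, hB⟩ := exists_Lp_inner_eq_integral (aemeasurable_omega W μ N)
    (by filter_upwards [hΩ] with x hx using (Real.sqrt_pos.2 hc).trans_le hx.1) N.memLp.1 hi
  refine ⟨(innerSL ℝ B).comp ((WithLp.fstL 2 ℝ (Lp ℝ 2 (omegaMeasure W μ N))
    (Lp (Vec d) 2 (densityMeasure N))).comp (PotentialSpace W μ N).subtypeL), fun ψ => ?_⟩
  refine (hB _).trans (integral_congr_ae (Eventually.of_forall fun x => ?_))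
  exact mul_comm _ _

end GrandCanonical

/-! ### Weak-* limits, and the distance as a dual norm -/

theorem exists_tendsto_ultrafilter_of_mem_Icc {ι : Type*} (U : Ultrafilter ι) {x : ι → ℝ} {a b : ℝ}
    (ha : ∀ k, a ≤ x k) (hb : ∀ k, x k ≤ b) : ∃ y, Tendsto x U (𝓝 y) := by
  obtain ⟨y, -, hy⟩ := (isCompact_Icc (a := a) (b := b)).ultrafilter_le_nhds (U.map x)
    (le_principal_iff.2 (Eventually.of_forall fun k => ⟨ha k, hb k⟩ : ∀ᶠ k in (U : Filter ι),
      x k ∈ Icc a b))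
  exact ⟨y, hy⟩

/-- Banach–Alaoglu along an ultrafilter: the bounded values converge pointwise, and the limit of the
norms bounds the limit functional. -/
theorem exists_weakDual_limit {ι E : Type*} [NormedAddCommGroup E] [NormedSpace ℝ E]
    (U : Ultrafilter ι) {G : ι → StrongDual ℝ E} {r : ℝ} (hr : ∀ k, ‖G k‖ ≤ r) :
    ∃ (G' : StrongDual ℝ E) (a : ℝ), (∀ ψ, Tendsto (fun k => G k ψ) U (𝓝 (G' ψ))) ∧
      Tendsto (fun k => ‖G k‖) U (𝓝 a) ∧ ‖G'‖ ≤ a := by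
  obtain ⟨a, ha⟩ := exists_tendsto_ultrafilter_of_mem_Icc U (fun k => norm_nonneg (G k)) hr
  have hlim : ∀ ψ, ∃ y, Tendsto (fun k => G k ψ) U (𝓝 y) := fun ψ => by
    have hb : ∀ k, |G k ψ| ≤ r * ‖ψ‖ := fun k =>
      ((G k).le_opNorm ψ).trans (mul_le_mul_of_nonneg_right (hr k) (norm_nonneg ψ))
    exact exists_tendsto_ultrafilter_of_mem_Icc U (fun k => (abs_le.1 (hb k)).1)
      fun k => (abs_le.1 (hb k)).2
  choose g hg using hlim
  have hle : ∀ ψ, ‖g ψ‖ ≤ a * ‖ψ‖ := fun ψ =>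
    le_of_tendsto_of_tendsto (hg ψ).norm (ha.mul_const ‖ψ‖)
      (Eventually.of_forall fun k => (G k).le_opNorm ψ)
  let g' : E →ₗ[ℝ] ℝ :=
    { toFun := g
      map_add' := fun ψ ψ' => tendsto_nhds_unique (hg (ψ + ψ')) (by
        simpa only [map_add] using (hg ψ).add (hg ψ'))
      map_smul' := fun c ψ => tendsto_nhds_unique (hg (c • ψ)) (by
        simpa only [map_smul, RingHom.id_apply] using (hg ψ).const_smul c) }
  exact ⟨g'.mkContinuous a hle, a, hg, ha, LinearMap.mkContinuous_norm_le _
    (ge_of_tendsto ha (Eventually.of_forall fun k => norm_nonneg (G k))) _⟩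

namespace GrandCanonical

/-- With `Φ` the Riesz representer of `F₀ - F`, the constant field `Φ / h` attains the value;
testing the endpoint constraint with `Φ` itself gives the lower bound. -/
theorem distSq_eq {d : ℕ} {L : ℝ} [Fact (0 < L)] {W : C(Torus d L, ℝ)} {μ : ℝ} {N₀ : Density d L}
    {h : ℝ} (hh : 0 < h) {F₀ : DualSpace W μ N₀}
    (hF₀ : ∀ ψ : PotentialSpace W μ N₀, F₀ ψ = ∫ x, N₀.toFun x * potential ψ x)
    (F : DualSpace W μ N₀) : distSq h F = ENNReal.ofReal (‖F₀ - F‖ ^ 2) := by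
  set Φ : PotentialSpace W μ N₀ := (InnerProductSpace.toDual ℝ _).symm (F₀ - F) with hΦ
  have hΦψ : ∀ ψ, inner ℝ Φ ψ = F₀ ψ - F ψ := fun ψ =>
    InnerProductSpace.toDual_symm_apply
  have hnorm : ‖F₀ - F‖ = ‖Φ‖ := 
    ((InnerProductSpace.toDual ℝ (PotentialSpace W μ N₀)).symm.norm_map (F₀ - F)).symm
  rw [hnorm]
  refine le_antisymm ?_ (le_iInf₂ fun φ hφ => ?_)
  · have hin : ∀ ψ : PotentialSpace W μ N₀, inner ℝ (h⁻¹ • Φ) ψ = h⁻¹ * (F₀ ψ - F ψ) := fun ψ =>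
      (real_inner_smul_left Φ ψ h⁻¹).trans (congrArg (h⁻¹ * ·) (hΦψ ψ))
    have hdr : Drives h (fun _ => h⁻¹ • Φ) F := by
      refine ⟨memLp_const _, fun t => F₀ - (t / h) • (F₀ - F), ?_, fun t _ ψ => ?_⟩
      · simp [hh.ne']
      · rw [intervalIntegral.integral_const, hin, ← hF₀]
        simp only [sub_apply, smul_apply, smul_eq_mul]
        ring
    refine (iInf₂_le (fun _ => h⁻¹ • Φ) hdr).trans_eq ?_
    rw [setLIntegral_const, Real.volume_Ioc, sub_zero, real_inner_self_eq_norm_sq, norm_smul,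
      ← ENNReal.ofReal_mul (by positivity), ← ENNReal.ofReal_mul hh.le, norm_inv,
      Real.norm_of_nonneg hh.le]
    congr 1
    field_simp
  · obtain ⟨hφ2, N, hNh, hN⟩ := hφ
    have hsq : Integrable (fun s => ‖φ s‖ ^ 2) (volume.restrict (Ioc 0 h)) :=
      (memLp_two_iff_integrable_sq_norm hφ2.1).1 hφ2
    have hφ1 : Integrable φ (volume.restrict (Ioc 0 h)) := hφ2.integrable (by norm_num)
    have h1 : ‖Φ‖ ^ 2 = ∫ s in Ioc 0 h, inner ℝ (φ s) Φ := by
      have := hN h ⟨hh.le, le_rfl⟩ Φ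
      rw [hNh, ← hF₀, intervalIntegral.integral_of_le hh.le] at this
      rw [← real_inner_self_eq_norm_sq, hΦψ]
      linarith
    -- Young's inequality, weighted so that equality holds at `φ s = Φ / h`.
    have h2 : ∫ s in Ioc 0 h, inner ℝ (φ s) Φ ≤
        ∫ s in Ioc 0 h, (h / 2 * ‖φ s‖ ^ 2 + ‖Φ‖ ^ 2 / (2 * h)) := by
      refine integral_mono (hφ1.inner_const Φ) ((hsq.const_mul _).add (integrable_const _))
        fun s => ?_
      refine (real_inner_le_norm _ _).trans ?_
      have h3 : h / 2 * ‖φ s‖ ^ 2 + ‖Φ‖ ^ 2 / (2 * h) - ‖φ s‖ * ‖Φ‖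
          = (h * ‖φ s‖ - ‖Φ‖) ^ 2 / (2 * h) := by
        field_simp
        ring
      have : 0 ≤ (h * ‖φ s‖ - ‖Φ‖) ^ 2 / (2 * h) := by positivity
      linarith
    rw [integral_add (hsq.const_mul _) (integrable_const _), integral_const_mul, integral_const,
      measureReal_restrict_apply_univ, Real.volume_real_Ioc_of_le hh.le, sub_zero, smul_eq_mul,
      ← h1] at h2
    have h3 : h * (‖Φ‖ ^ 2 / (2 * h)) = ‖Φ‖ ^ 2 / 2 := by field_simp
    simp_rw [real_inner_self_eq_norm_sq]
    rw [← ofReal_integral_eq_lintegral_ofReal hsq (Eventually.of_forall fun s => by positivity),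
      ← ENNReal.ofReal_mul hh.le]
    refine ENNReal.ofReal_le_ofReal ?_
    linarith

/-! ### The direct method -/

theorem HStable.interaction_nonneg {d : ℕ} {L : ℝ} [Fact (0 < L)] {W : C(Torus d L, ℝ)}
    (hW : HStable W) {n : Torus d L → ℝ} (hn : Integrable n) (hpos : ∀ᵐ x, 0 ≤ n x) :
    0 ≤ ∫ x, ∫ y, W (x - y) * n x * n y := by
  have hae : (fun x => max (n x) 0) =ᵐ[volume] n := by
    filter_upwards [hpos] with x hx using max_eq_left hx
  refine (hW (fun x => max (n x) 0) hn.pos_part fun x => le_max_right _ _).trans_eq ?_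
  refine integral_congr_ae ?_
  filter_upwards [hae] with x hx
  refine integral_congr_ae ?_
  filter_upwards [hae] with y hy
  rw [hx, hy]

/-- The finite values of the free energy. -/
noncomputable def energy {d : ℕ} {L : ℝ} [Fact (0 < L)] (W : C(Torus d L, ℝ)) (μ : ℝ) (n : Torus d L → ℝ) : ℝ :=
  (∫ x, (n x * Real.log (n x) - (n x + μ * n x))) + 1 / 2 * ∫ x, ∫ y, W (x - y) * n x * n y

/-- `n` is a nonnegative density of finite entropy which represents `F`. -/
structure IsAdmissible {d : ℕ} {L : ℝ} [Fact (0 < L)] {W : C(Torus d L, ℝ)} {μ : ℝ}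
    {N₀ : Density d L} (F : DualSpace W μ N₀) (n : Torus d L → ℝ) : Prop where
  isL1 : IsL1Function F n
  nonneg : ∀ᵐ x, 0 ≤ n x
  integrable_log : Integrable fun x => n x * Real.log (n x)

theorem IsAdmissible.entropy_ge {d : ℕ} {L : ℝ} [Fact (0 < L)] {W : C(Torus d L, ℝ)} {μ : ℝ}
    {N₀ : Density d L} {F : DualSpace W μ N₀} {n : Torus d L → ℝ} (hn : IsAdmissible F n) :
    -(2 * Real.exp μ * (volume : Measure (Torus d L)).real univ)
      ≤ ∫ x, (n x * Real.log (n x) - (n x + μ * n x)) := by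
  have := mul_setIntegral_le_entropy hn.isL1.1 hn.nonneg hn.integrable_log μ 0 MeasurableSet.univ
  rw [zero_mul, add_zero] at this
  linarith

theorem isAdmissible_density {d : ℕ} {L : ℝ} [Fact (0 < L)] {W : C(Torus d L, ℝ)} {μ : ℝ}
    {N₀ : Density d L} {F₀ : DualSpace W μ N₀}
    (hF₀ : ∀ ψ : PotentialSpace W μ N₀, F₀ ψ = ∫ x, N₀.toFun x * potential ψ x) :
    IsAdmissible F₀ N₀.toFun := by
  obtain ⟨c, hc, h⟩ := N₀.bounded_below
  have hm := N₀.memLp.1.aemeasurable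
  refine ⟨⟨N₀.memLp.integrable (by norm_num), fun ψ _ => hF₀ ψ⟩,
    by filter_upwards [h] with x hx using hc.le.trans hx, ?_⟩
  refine (N₀.memLp.integrable_sq.add (integrable_const (1 : ℝ))).mono'
    (AEMeasurable.aestronglyMeasurable (by fun_prop)) ?_
  filter_upwards [h] with x hx
  have h0 : 0 < N₀.toFun x := hc.trans_le hx
  have h1 := mul_le_mul_log_sub_add_exp h0.le 0
  rw [mul_zero, Real.exp_zero] at h1
  have h2 := Real.log_le_sub_one_of_pos h0
  rw [Real.norm_eq_abs, abs_le]
  simp only [Pi.add_apply]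
  -- From `N - 1 ≤ N log N ≤ N ^ 2 - N`.
  constructor <;> nlinarith

theorem half_distSq_eq {d : ℕ} {L : ℝ} [Fact (0 < L)] {W : C(Torus d L, ℝ)} {μ : ℝ}
    {N₀ : Density d L} {h : ℝ} (hh : 0 < h) {F₀ : DualSpace W μ N₀}
    (hF₀ : ∀ ψ : PotentialSpace W μ N₀, F₀ ψ = ∫ x, N₀.toFun x * potential ψ x)
    (F : DualSpace W μ N₀) :
    ((1 / 2 * distSq h F : ℝ≥0∞) : EReal) = ((1 / 2 * ‖F₀ - F‖ ^ 2 : ℝ) : EReal) := by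
  have : (1 / 2 : ℝ≥0∞) = ENNReal.ofReal (1 / 2) := by
    rw [ENNReal.ofReal_div_of_pos two_pos]
    simp
  rw [distSq_eq hh hF₀, this, ← ENNReal.ofReal_mul (by positivity), EReal.coe_ennreal_ofReal,
    max_eq_left (by positivity)]

theorem approxJKO_le {d : ℕ} {L : ℝ} [Fact (0 < L)] {W : C(Torus d L, ℝ)} {μ : ℝ}
    {N₀ : Density d L} {h : ℝ} (hh : 0 < h) {F₀ : DualSpace W μ N₀}
    (hF₀ : ∀ ψ : PotentialSpace W μ N₀, F₀ ψ = ∫ x, N₀.toFun x * potential ψ x)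
    {F : DualSpace W μ N₀} {n : Torus d L → ℝ} (hn : IsAdmissible F n) :
    approxJKO W μ h N₀ F ≤ ((1 / 2 * ‖F₀ - F‖ ^ 2 + h * energy W μ n : ℝ) : EReal) := by
  have hle : freeEnergyDual F ≤ (energy W μ n : EReal) := by
    refine (iInf₂_le n ⟨hn.isL1, hn.nonneg⟩).trans_eq ?_
    rw [freeEnergy, if_pos hn.integrable_log]
    rfl
  rw [approxJKO, half_distSq_eq hh hF₀, EReal.coe_add, EReal.coe_mul]
  exact add_le_add le_rfl (mul_le_mul_of_nonneg_left hle (by exact_mod_cast hh.le))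

/-- Only admissible densities contribute finite values to the infimum in `freeEnergyDual`. If there
are none, `hr` is vacuous and every real `r` is a lower bound. -/
theorem le_approxJKO {d : ℕ} {L : ℝ} [Fact (0 < L)] {W : C(Torus d L, ℝ)} {μ : ℝ}
    {N₀ : Density d L} {h : ℝ} (hh : 0 < h) {F₀ : DualSpace W μ N₀}
    (hF₀ : ∀ ψ : PotentialSpace W μ N₀, F₀ ψ = ∫ x, N₀.toFun x * potential ψ x)
    {F : DualSpace W μ N₀} {r : ℝ}
    (hr : ∀ n, IsAdmissible F n → r ≤ 1 / 2 * ‖F₀ - F‖ ^ 2 + h * energy W μ n) :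
    (r : EReal) ≤ approxJKO W μ h N₀ F := by
  have hle : (((r - 1 / 2 * ‖F₀ - F‖ ^ 2) / h : ℝ) : EReal) ≤ freeEnergyDual F := by
    refine le_iInf₂ fun n hn => ?_
    unfold freeEnergy
    split_ifs with hlog
    · rw [EReal.coe_le_coe_iff, div_le_iff₀ hh]
      have := hr n ⟨hn.1, hn.2, hlog⟩
      unfold energy at this
      linarith
    · exact le_top
  calc (r : EReal) = ((1 / 2 * ‖F₀ - F‖ ^ 2 : ℝ) : EReal)
        + (h : EReal) * (((r - 1 / 2 * ‖F₀ - F‖ ^ 2) / h : ℝ) : EReal) := by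
        rw [← EReal.coe_mul, ← EReal.coe_add, mul_div_cancel₀ _ hh.ne', add_sub_cancel]
    _ ≤ approxJKO W μ h N₀ F := by
        rw [approxJKO, half_distSq_eq hh hF₀]
        exact add_le_add le_rfl (mul_le_mul_of_nonneg_left hle (by exact_mod_cast hh.le))

/-- Sequential compactness of the admissible pairs and lower semicontinuity of the functional. -/
theorem exists_admissible_le {d : ℕ} {L : ℝ} [Fact (0 < L)] {W : C(Torus d L, ℝ)}
    (hW : HStable W) {μ : ℝ} {N₀ : Density d L} {h : ℝ} (hh : 0 < h) (F₀ : DualSpace W μ N₀)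
    {F : ℕ → DualSpace W μ N₀} {n : ℕ → Torus d L → ℝ} (hn : ∀ k, IsAdmissible (F k) (n k)) {s : ℝ}
    (hs : ∀ k : ℕ, 1 / 2 * ‖F₀ - F k‖ ^ 2 + h * energy W μ (n k) ≤ s + 1 / ((k : ℝ) + 1)) :
    ∃ (F' : DualSpace W μ N₀) (n' : Torus d L → ℝ), IsAdmissible F' n' ∧
      1 / 2 * ‖F₀ - F'‖ ^ 2 + h * energy W μ n' ≤ s := by
  have hi : ∀ k, Integrable (n k) := fun k => (hn k).isL1.1
  have hpos : ∀ k, ∀ᵐ x, 0 ≤ n k x := fun k => (hn k).nonneg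
  have hlog : ∀ k, Integrable fun x => n k x * Real.log (n k x) := fun k => (hn k).integrable_log
  set B : ℝ := 2 * Real.exp μ * (volume : Measure (Torus d L)).real univ with hB
  have hI : ∀ k, 0 ≤ ∫ x, ∫ y, W (x - y) * n k x * n k y := fun k =>
    hW.interaction_nonneg (hi k) (hpos k)
  have hs1 : ∀ k, 1 / 2 * ‖F₀ - F k‖ ^ 2
      + h * (∫ x, (n k x * Real.log (n k x) - (n k x + μ * n k x))) ≤ s + 1 := by
    intro k
    have h1 := hs k
    have h2 : 1 / ((k : ℝ) + 1) ≤ 1 := by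
      rw [div_le_one (by positivity)]
      have : (0 : ℝ) ≤ k := k.cast_nonneg
      linarith
    have h3 := mul_nonneg hh.le (hI k)
    unfold energy at h1
    rw [mul_add] at h1
    linarith
  have hent : ∀ k, ∫ x, (n k x * Real.log (n k x) - (n k x + μ * n k x)) ≤ (s + 1) / h := by
    intro k
    rw [le_div_iff₀ hh]
    have := hs1 k
    nlinarith [sq_nonneg ‖F₀ - F k‖]
  have hent' : ∀ k, -B ≤ ∫ x, (n k x * Real.log (n k x) - (n k x + μ * n k x)) := fun k =>
    (hn k).entropy_ge
  have hnorm : ∀ k, ‖F₀ - F k‖ ≤ √(2 * (s + 1 + h * B)) := by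
    intro k
    refine Real.le_sqrt_of_sq_le ?_
    have h1 := hs1 k
    have h2 := mul_le_mul_of_nonneg_left (hent' k) hh.le
    linarith
  have hmass : ∀ k, ∫ x, n k x ≤ (s + 1) / h
      + Real.exp μ * (volume : Measure (Torus d L)).real univ
      + Real.exp (μ + 1) * (volume : Measure (Torus d L)).real univ := by
    intro k
    have := mul_setIntegral_le_entropy (hi k) (hpos k) (hlog k) μ 1 MeasurableSet.univ
    rw [one_mul, setIntegral_univ] at this
    linarith [hent k]
  -- One nonprincipal ultrafilter serves all limits, so they are compatible.
  let U : Ultrafilter ℕ := hyperfilter ℕ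
  obtain ⟨f, hf, hfpos, hlim⟩ := exists_weak_limit_of_unifIntegrable U hi hpos
    (unifIntegrable_of_entropy_le hi hpos hlog hent) hmass
  obtain ⟨e, he⟩ := exists_tendsto_ultrafilter_of_mem_Icc U hent' hent
  obtain ⟨G, a, hG, ha, hGa⟩ := exists_weakDual_limit U hnorm
  obtain ⟨hflog, hfe⟩ := entropy_le_of_tendsto hi hpos hlog hf hfpos hlim he
  have hint := tendsto_interaction (K := fun x y => W (x - y)) (by fun_prop) hi hpos hmass hf
    hfpos hlim
  -- `G` is the weak-* limit of `F₀ - F k`. Weak `L¹` convergence identifies `F₀ - G` with `f` only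
  -- on bounded `ψ`, which is all that `IsL1Function` asks.
  refine ⟨F₀ - G, f, ⟨⟨hf, fun ψ ⟨C, hC⟩ => ?_⟩, Eventually.of_forall hfpos, hflog⟩, ?_⟩
  · have h1 : Tendsto (fun k => F k ψ) U (𝓝 ((F₀ - G) ψ)) := by
      refine ((tendsto_const_nhds (x := F₀ ψ)).sub (hG ψ)).congr fun k => ?_
      simp
    have hm : AEStronglyMeasurable (potential ψ) volume :=
      (HasWeakGradient.integrable ψ.2).1
    refine tendsto_nhds_unique h1 ((hlim _ hm C hC).congr fun k => ?_)
    exact ((hn k).isL1.2 ψ ⟨C, hC⟩).symm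
  · have hval := ((ha.pow 2).const_mul (1 / 2)).add ((he.add (hint.const_mul (1 / 2))).const_mul h)
    have hright : Tendsto (fun k : ℕ => s + 1 / ((k : ℝ) + 1)) U (𝓝 s) := by
      have := (tendsto_one_div_add_atTop_nhds_zero_nat (𝕜 := ℝ)).const_add s
      rw [add_zero] at this
      exact this.mono_left Nat.hyperfilter_le_atTop
    have hle := le_of_tendsto_of_tendsto hval hright (Eventually.of_forall hs)
    refine le_trans ?_ hle
    rw [sub_sub_cancel, energy]
    gcongr

end GrandCanonical

theorem mainTheorem7 (d : ℕ) (L : ℝ) [Fact (0 < L)] (W : C(GrandCanonical.Torus d L, ℝ))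
    (hW : GrandCanonical.HStable W) (μ h : ℝ) (hh : 0 < h)
    (N₀ : GrandCanonical.Density d L) :
    (∃ F : GrandCanonical.DualSpace W μ N₀,
      ∀ F', GrandCanonical.approxJKO W μ h N₀ F ≤ GrandCanonical.approxJKO W μ h N₀ F') ∧
    ∀ F : GrandCanonical.DualSpace W μ N₀,
      (∀ F', GrandCanonical.approxJKO W μ h N₀ F ≤ GrandCanonical.approxJKO W μ h N₀ F') →
      (∃ r : ℝ, GrandCanonical.approxJKO W μ h N₀ F = (r : EReal)) ∧
      ∃ n : GrandCanonical.Torus d L → ℝ,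
        (∀ᵐ x, 0 ≤ n x) ∧ GrandCanonical.IsL1Function F n := by
  obtain ⟨F₀, hF₀⟩ := GrandCanonical.exists_dual_density W μ N₀
  have hadm₀ := GrandCanonical.isAdmissible_density hF₀
  set S : Set ℝ := {r | ∃ (F : GrandCanonical.DualSpace W μ N₀) (n : GrandCanonical.Torus d L → ℝ),
    GrandCanonical.IsAdmissible F n ∧
      r = 1 / 2 * ‖F₀ - F‖ ^ 2 + h * GrandCanonical.energy W μ n} with hS
  have hne : S.Nonempty := ⟨_, F₀, _, hadm₀, rfl⟩
  have hbdd : BddBelow S := by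
    refine ⟨h * -(2 * Real.exp μ * (volume : Measure (GrandCanonical.Torus d L)).real univ), ?_⟩
    rintro _ ⟨F, n, hn, rfl⟩
    have h1 := mul_le_mul_of_nonneg_left hn.entropy_ge hh.le
    have h2 := mul_nonneg hh.le (hW.interaction_nonneg hn.isL1.1 hn.nonneg)
    unfold GrandCanonical.energy
    rw [mul_add]
    nlinarith [sq_nonneg ‖F₀ - F‖]
  have hlow : ∀ F' : GrandCanonical.DualSpace W μ N₀,
      ((sInf S : ℝ) : EReal) ≤ GrandCanonical.approxJKO W μ h N₀ F' := fun F' =>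
    GrandCanonical.le_approxJKO hh hF₀ fun n hn => csInf_le hbdd ⟨F', n, hn, rfl⟩
  refine ⟨?_, fun F hF => ⟨?_, ?_⟩⟩
  · have hseq : ∀ k : ℕ, ∃ (F : GrandCanonical.DualSpace W μ N₀)
        (n : GrandCanonical.Torus d L → ℝ), GrandCanonical.IsAdmissible F n ∧
        1 / 2 * ‖F₀ - F‖ ^ 2 + h * GrandCanonical.energy W μ n
          ≤ sInf S + 1 / ((k : ℝ) + 1) := by
      intro k
      obtain ⟨_, ⟨F, n, hn, rfl⟩, hlt⟩ := exists_lt_of_csInf_lt hne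
        (lt_add_of_pos_right (sInf S) (by positivity : (0 : ℝ) < 1 / ((k : ℝ) + 1)))
      exact ⟨F, n, hn, hlt.le⟩
    choose F n hn hle using hseq
    obtain ⟨F', n', hn', hle'⟩ := GrandCanonical.exists_admissible_le hW hh F₀ hn hle
    exact ⟨F', fun G => (GrandCanonical.approxJKO_le hh hF₀ hn').trans
      ((EReal.coe_le_coe_iff.2 hle').trans (hlow G))⟩
  -- Comparison with `F₀` excludes `⊤`, and the bound by `sInf S` excludes `⊥`.
  · have hup := (hF F₀).trans (GrandCanonical.approxJKO_le hh hF₀ hadm₀)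
    exact ⟨_, (EReal.coe_toReal (hup.trans_lt (EReal.coe_lt_top _)).ne
      ((EReal.bot_lt_coe _).trans_le (hlow F)).ne').symm⟩
  · by_contra hno
    have hup := (hF F₀).trans (GrandCanonical.approxJKO_le hh hF₀ hadm₀)
    -- Without a representing density the lower bound holds vacuously for any `r`; the `+ 1` puts it
    -- above the upper bound from `F₀`.
    have := (GrandCanonical.le_approxJKO hh hF₀ (F := F)
      (r := 1 / 2 * ‖F₀ - F₀‖ ^ 2 + h * GrandCanonical.energy W μ N₀.toFun + 1)
      fun n hn => absurd ⟨n, hn.nonneg, hn.isL1⟩ hno).trans hup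
    rw [EReal.coe_le_coe_iff] at this
    linarith
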